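/- Let $d,k$ be integers with $1\le k\le d-1$, and let $(M_n)_{n\ge1}$, $(N_n)_{n\ge1}$ be sequences of integers with $M_n\ge2$, $1\le N_n\le M_n^d$ and $\sup_n M_n<\infty$. Put $r_n=\prod_{i=1}^n M_i^{-1}$, $P_n=\prod_{i=1}^n N_i$ and $$s=\liminf_{n\to\infty}\frac{\log P_n}{-\log r_n}.$$ For $n\ge0$ let $D_n$ be the family of the $r_n^{-d}$ closed cubes of side $r_n$ into which the grid of mesh $r_n$ decomposes $[0,1]^d$. Let $E_0=[0,1]^d$, and let $E_1,E_2,\dots$ be random sets, $E_n$ being the union of a random collection of $P_n$ cubes of $D_n$, produced as follows: given $E_n$, inside each of the cubes of $D_n$ that form $E_n$ one chooses exactly $N_{n+1}$ of its $M_{n+1}^d$ subcubes in $D_{n+1}$, in such a way that (conditionally on $E_n$) each subcube is chosen with probability $N_{n+1}/M_{n+1}^d$ and the choices inside the different cubes forming $E_n$ are independent; $E_{n+1}$ is the union of all the chosen subcubes. (The joint law of the choice inside one cube is otherwise arbitrary.) Let $E=\bigcap_{n}E_n$. Almost surely there is a unique Borel measure $\mu$ on $[0,1]^d$, the natural measure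 of $E$, such that for every $n\ge0$ and $Q\in D_n$ one has $\mu(Q)=P_n^{-1}$ if $Q\subset E_n$ and $\mu(Q)=0$ otherwise. Let $A(d,d-k)$ be the set of all $(d-k)$-dimensional affine planes of $\mathbb R^d$ that intersect $[0,1]^d$. For $W\in A(d,d-k)$ and $\delta>0$, the strip of width $w(S)=\delta$ defined by $W$ is $S=\{x\in\mathbb R^d:\operatorname{dist}(x,W)<\delta/2\}$; let $S(d,d-k)$ be the set of all these strips. If $s\le k$, then almost surely, simultaneously for all $t$ with $0<t<s$, $$\sup_{S\in S(d,d-k)}\frac{\mu(E\cap S)}{w(S)^t}<\infty .$$ -/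

import Mathlib

open MeasureTheory
open scoped ENNReal

noncomputable section

/-- Indices of the closed `r_n`-adic subcubes of `[0,1]^d`. The sequences `M_1, M_2, …` and
`N_1, N_2, …` are `M 0, M 1, …` and `N 0, N 1, …`, and each side of the unit cube is cut into
`M_1 ⋯ M_n` intervals at level `n`. -/
abbrev CubeIdx (d : ℕ) (M : ℕ → ℕ) (n : ℕ) : Type :=
  Fin d → Fin (∏ i ∈ Finset.range n, M i)

/-- The side length `r_n = ∏_{i ≤ n} M_i⁻¹`. -/
def sideLength (M : ℕ → ℕ) (n : ℕ) : ℝ := ∏ i ∈ Finset.range n, ((M i : ℝ))⁻¹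

/-- The number `P_n = ∏_{i ≤ n} N_i` of chosen cubes at level `n`. -/
def numChosen (N : ℕ → ℕ) (n : ℕ) : ℕ := ∏ i ∈ Finset.range n, N i

/-- The number `s = liminf log P_n / (- log r_n)`. -/
def cantorDim (M N : ℕ → ℕ) : ℝ :=
  Filter.liminf
    (fun n : ℕ => Real.log (numChosen N n : ℝ) / (-Real.log (sideLength M n))) Filter.atTop

/-- The closed unit cube `[0,1]^d`. -/
def unitCube (d : ℕ) : Set (EuclideanSpace ℝ (Fin d)) :=
  {x | ∀ i, 0 ≤ x i ∧ x i ≤ 1}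

/-- The closed cube of `D_n` with index `j`. -/
def adicCube {d : ℕ} {M : ℕ → ℕ} {n : ℕ} (j : CubeIdx d M n) :
    Set (EuclideanSpace ℝ (Fin d)) :=
  {x | ∀ i, ((j i : ℕ) : ℝ) * sideLength M n ≤ x i ∧
    x i ≤ (((j i : ℕ) : ℝ) + 1) * sideLength M n}

/-- The indices of the `M_{n+1}^d` cubes of `D_{n+1}` into which the cube with index `j` of `D_n`
is cut. -/
def children {d : ℕ} {M : ℕ → ℕ} {n : ℕ} (j : CubeIdx d M n) : Finset (CubeIdx d M (n + 1)) :=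
  Finset.univ.filter fun l => ∀ i, (l i : ℕ) / M n = (j i : ℕ)

/-- `C n ω` is the collection of (indices of) the chosen cubes at level `n`, whose union is `E_n`.
The conditions say that `C` follows the random construction. Since `C n` determines the chosen
cubes of all earlier levels, conditioning on `C n` is conditioning on the whole past. As in the
construction, the law of the choice inside a cube is only required to have equal
marginal probabilities. -/
structure IsRandomCantor {Ω : Type*} [MeasurableSpace Ω] (Pr : Measure Ω) (d : ℕ) (M N : ℕ → ℕ)
    (C : (n : ℕ) → Ω → Finset (CubeIdx d M n)) : Prop where
  /-- `C n` is a random variable with values in a finite set. -/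
  measurableSet_eq : ∀ n (e : Finset (CubeIdx d M n)), MeasurableSet {ω | C n ω = e}
  /-- The construction starts from the unit cube. -/
  level_zero : ∀ ω, C 0 ω = Finset.univ
  /-- The cubes of level `n + 1` are chosen inside those of level `n`. -/
  exists_parent : ∀ n ω, ∀ l ∈ C (n + 1) ω, ∃ j ∈ C n ω, l ∈ children j
  /-- Inside each cube of level `n`, exactly `N_{n+1}` subcubes are chosen. -/
  card_chosen : ∀ n ω, ∀ j ∈ C n ω, (C (n + 1) ω ∩ children j).card = N n
  /-- Given level `n`, each subcube of each cube of level `n` is chosen with the same probability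
  `N_{n+1} / M_{n+1}^d`. -/
  prob_chosen : ∀ n (e : Finset (CubeIdx d M n)), Pr {ω | C n ω = e} ≠ 0 →
    ∀ j ∈ e, ∀ l ∈ children j,
      ProbabilityTheory.cond Pr {ω | C n ω = e} {ω | l ∈ C (n + 1) ω}
        = (N n : ℝ≥0∞) / (M n : ℝ≥0∞) ^ d
  /-- Given level `n`, the choices inside the different cubes of level `n` are independent. -/
  indep_chosen : ∀ n (e : Finset (CubeIdx d M n)), Pr {ω | C n ω = e} ≠ 0 →
    ProbabilityTheory.iIndepFun (m := fun _ => (⊤ : MeasurableSpace (Finset (CubeIdx d M (n + 1)))))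
      (fun (j : {j // j ∈ e}) (ω : Ω) => C (n + 1) ω ∩ children j.1)
      (ProbabilityTheory.cond Pr {ω | C n ω = e})

/-- The set `E_n`, for one realization `c` of the collections of chosen cubes. -/
def levelSet {d : ℕ} {M : ℕ → ℕ} (c : (n : ℕ) → Finset (CubeIdx d M n)) (n : ℕ) :
    Set (EuclideanSpace ℝ (Fin d)) :=
  ⋃ j ∈ c n, adicCube j

/-- The limit set `E = ⋂_n E_n` (with `E_0 = [0,1]^d`). -/
def limitSet {d : ℕ} {M : ℕ → ℕ} (c : (n : ℕ) → Finset (CubeIdx d M n)) :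
    Set (EuclideanSpace ℝ (Fin d)) :=
  ⋂ n, levelSet c n

/-- `μ` is a measure on `[0,1]^d` with `μ Q = P_n⁻¹` for the chosen cubes `Q` of `D_n`
and `μ Q = 0` for the other cubes of `D_n`. -/
def IsNaturalMeasure {d : ℕ} {M : ℕ → ℕ} (N : ℕ → ℕ) (c : (n : ℕ) → Finset (CubeIdx d M n))
    (μ : Measure (EuclideanSpace ℝ (Fin d))) : Prop :=
  μ (unitCube d)ᶜ = 0 ∧
    ∀ n (j : CubeIdx d M n), μ (adicCube j) = if j ∈ c n then ((numChosen N n : ℝ≥0∞))⁻¹ else 0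

/-- `A(d,m)`: the `m`-dimensional affine planes of `ℝ^d` that intersect `[0,1]^d`. -/
def planesMeetingCube (d m : ℕ) : Set (AffineSubspace ℝ (EuclideanSpace ℝ (Fin d))) :=
  {W | Module.finrank ℝ W.direction = m ∧
    ((W : Set (EuclideanSpace ℝ (Fin d))) ∩ unitCube d).Nonempty}

/-- The strip of width `δ` defined by `W`. -/
def strip {d : ℕ} (W : AffineSubspace ℝ (EuclideanSpace ℝ (Fin d))) (δ : ℝ) :
    Set (EuclideanSpace ℝ (Fin d)) :=
  {x | Metric.infDist x (W : Set (EuclideanSpace ℝ (Fin d))) < δ / 2}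

end

/-! For width δ comparable to r_n, the cubes of level n that meet a strip lie in a tube: a bounded
neighbourhood, in units of r_n, of a plane whose coefficients have been rounded to multiples of r_n.
Rounding leaves only polynomially many tubes in r_n⁻¹ (`exists_tubeParams`, `card_tubeParams`).
Hence it is enough that one fixed tube contains more than P_n r_n^t chosen cubes with probability
decaying faster than every power of r_n; a union bound and Borel–Cantelli then give
`ae_card_tube_le`.

The tail comes from an exponential moment, computed backwards along the tree. A tube has q = d - k
free coordinates, so the conditional expectation of the number of its chosen cubes inside a chosen
cube of level m is O((P_n/P_m)(r_n/r_m)^k) (`tubeWeight_le`). For σ < s one has P_m r_m^σ ≥ c₀, and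
σ ≤ k because s ≤ k, so this is O(P_n r_n^σ) uniformly in m. Take t < τ < σ and θ = r_n^(-τ)/P_n.
After multiplication by θ all these quantities are O(r_n^(σ-τ)), eventually below 1/n. For exponents
0 ≤ x ≤ 1/n one has e^x ≤ 1 + (1 + 1/n)x, so by independence each step towards the root replaces the
exponent by (1 + 1/n) times its conditional expectation (`lintegral_exp_level_succ_le`). The n steps
cost at most a factor e, the exponent at the root is O(1), and Markov's inequality yields a tail of
order exp(-r_n^(-(τ-t))).

The natural measure is a weak limit of uniform measures on corners of chosen cubes. Closed cubes
share faces, so exact masses require the grid hyperplanes to be null; almost surely they are,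
because the expected share of chosen cubes near a given hyperplane is summable over the levels
(`ae_tendsto_slabMass`). -/

noncomputable section

/-! ### Side lengths and cube counts. -/

section Scales

variable {M N : ℕ → ℕ}

theorem sideLength_eq (M : ℕ → ℕ) (n : ℕ) :
    sideLength M n = ((∏ i ∈ Finset.range n, M i : ℕ) : ℝ)⁻¹ := by
  simp [sideLength]

theorem sideLength_succ (M : ℕ → ℕ) (n : ℕ) :
    sideLength M (n + 1) = sideLength M n * (M n : ℝ)⁻¹ :=
  Finset.prod_range_succ _ _

theorem numChosen_succ (N : ℕ → ℕ) (n : ℕ) : numChosen N (n + 1) = numChosen N n * N n :=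
  Finset.prod_range_succ _ _

theorem prod_range_pos (hM : ∀ n, 2 ≤ M n) (n : ℕ) : 0 < ∏ i ∈ Finset.range n, M i :=
  Finset.prod_pos fun i _ => by have := hM i; omega

theorem prod_Ico_pos (hM : ∀ n, 2 ≤ M n) (m n : ℕ) : 0 < ∏ i ∈ Finset.Ico m n, M i :=
  Finset.prod_pos fun i _ => by have := hM i; omega

theorem sideLength_pos (hM : ∀ n, 2 ≤ M n) (n : ℕ) : 0 < sideLength M n := by
  rw [sideLength_eq]
  exact inv_pos.2 (by exact_mod_cast prod_range_pos hM n)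

theorem numChosen_pos (hN : ∀ n, 1 ≤ N n) (n : ℕ) : 0 < numChosen N n :=
  Finset.prod_pos fun i _ => hN i

theorem sideLength_mul_prod_range (hM : ∀ n, 2 ≤ M n) (n : ℕ) :
    sideLength M n * ((∏ i ∈ Finset.range n, M i : ℕ) : ℝ) = 1 := by
  rw [sideLength_eq]
  exact inv_mul_cancel₀ (by exact_mod_cast (prod_range_pos hM n).ne')

theorem sideLength_eq_mul_prod_Ico (hM : ∀ n, 2 ≤ M n) {m n : ℕ} (h : m ≤ n) :
    sideLength M m = sideLength M n * ((∏ i ∈ Finset.Ico m n, M i : ℕ) : ℝ) := by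
  have h1 := Finset.prod_range_mul_prod_Ico M h
  have h2 := prod_range_pos hM m
  have h3 := prod_Ico_pos hM m n
  rw [sideLength_eq, sideLength_eq, ← h1]
  push_cast
  have h2' : (0 : ℝ) < ∏ i ∈ Finset.range m, (M i : ℝ) := by exact_mod_cast h2
  have h3' : (0 : ℝ) < ∏ i ∈ Finset.Ico m n, (M i : ℝ) := by exact_mod_cast h3
  field_simp

theorem sideLength_le_two_pow (hM : ∀ n, 2 ≤ M n) (n : ℕ) : sideLength M n ≤ (1 / 2 : ℝ) ^ n := by
  rw [sideLength, ← Finset.card_range n, ← Finset.prod_const, Finset.card_range]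
  refine Finset.prod_le_prod (fun i _ => by positivity) fun i _ => ?_
  rw [one_div]
  exact inv_anti₀ (by norm_num) (by exact_mod_cast hM i)

theorem sideLength_antitone (hM : ∀ n, 2 ≤ M n) : Antitone (sideLength M) := by
  refine antitone_nat_of_succ_le fun n => ?_
  rw [sideLength_succ]
  have h : (M n : ℝ)⁻¹ ≤ 1 := inv_le_one_of_one_le₀ (by exact_mod_cast (by have := hM n; omega))
  exact mul_le_of_le_one_right (sideLength_pos hM n).le h

theorem sideLength_le_one (hM : ∀ n, 2 ≤ M n) (n : ℕ) : sideLength M n ≤ 1 := by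
  simpa [sideLength] using sideLength_antitone hM (Nat.zero_le n)

theorem tendsto_sideLength (hM : ∀ n, 2 ≤ M n) :
    Filter.Tendsto (sideLength M) Filter.atTop (nhds 0) :=
  squeeze_zero (fun n => (sideLength_pos hM n).le) (sideLength_le_two_pow hM)
    (tendsto_pow_atTop_nhds_zero_of_lt_one (by norm_num) (by norm_num))

theorem numChosen_eq_mul_prod_Ico (N : ℕ → ℕ) {m n : ℕ} (h : m ≤ n) :
    numChosen N n = numChosen N m * ∏ i ∈ Finset.Ico m n, N i :=
  (Finset.prod_range_mul_prod_Ico N h).symm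

end Scales

/-! ### The tree of adic cubes and its chosen subtrees. -/

section Ancestors

variable {d : ℕ} {M : ℕ → ℕ}

/-- The index of the cube of level `m` that contains the cube with index `l` of level `n`. -/
def ancestor {m n : ℕ} (h : m ≤ n) (l : CubeIdx d M n) : CubeIdx d M m := fun i =>
  ⟨(l i : ℕ) / ∏ i ∈ Finset.Ico m n, M i, Nat.div_lt_of_lt_mul (by
    rw [mul_comm, Finset.prod_range_mul_prod_Ico M h]; exact (l i).2)⟩

theorem ancestor_self {n : ℕ} (l : CubeIdx d M n) : ancestor le_rfl l = l := by
  ext i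
  simp [ancestor]

theorem ancestor_ancestor {m n p : ℕ} (h : m ≤ n) (h' : n ≤ p) (l : CubeIdx d M p) :
    ancestor h (ancestor h' l) = ancestor (h.trans h') l := by
  ext i
  simp only [ancestor]
  rw [Nat.div_div_eq_div_mul, mul_comm, Finset.prod_Ico_consecutive M h h']

theorem mem_children_iff {n : ℕ} (j : CubeIdx d M n) (l : CubeIdx d M (n + 1)) :
    l ∈ children j ↔ ancestor n.le_succ l = j := by
  simp [children, ancestor, funext_iff, Fin.ext_iff]

theorem ancestor_succ_eq_iff {m n : ℕ} (h : m < n) (j : CubeIdx d M m) (l : CubeIdx d M n) :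
    ancestor h.le l = j ↔ ancestor (Nat.succ_le_of_lt h) l ∈ children j := by
  rw [mem_children_iff, ancestor_ancestor]

theorem adicCube_subset_adicCube_ancestor (hM : ∀ n, 2 ≤ M n) {m n : ℕ} (h : m ≤ n)
    (l : CubeIdx d M n) : adicCube l ⊆ adicCube (ancestor h l) := by
  intro x hx i
  obtain ⟨h1, h2⟩ := hx i
  have hD := prod_Ico_pos hM m n
  set D := ∏ i ∈ Finset.Ico m n, M i with hDdef
  have hr := sideLength_pos hM n
  have h3 : (l i : ℕ) / D * D ≤ (l i : ℕ) := Nat.div_mul_le_self _ _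
  have h4 : (l i : ℕ) + 1 ≤ ((l i : ℕ) / D + 1) * D := Nat.lt_mul_of_div_lt (Nat.lt_succ_self _) hD
  have h3' : (((l i : ℕ) / D : ℕ) : ℝ) * D ≤ ((l i : ℕ) : ℝ) := by exact_mod_cast h3
  have h4' : ((l i : ℕ) : ℝ) + 1 ≤ ((((l i : ℕ) / D : ℕ) : ℝ) + 1) * D := by exact_mod_cast h4
  rw [sideLength_eq_mul_prod_Ico hM h]
  simp only [ancestor]
  rw [← hDdef]
  constructor
  · calc _ = ((((l i : ℕ) / D : ℕ) : ℝ) * D) * sideLength M n := by ring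
      _ ≤ ((l i : ℕ) : ℝ) * sideLength M n := by gcongr
      _ ≤ _ := h1
  · calc _ ≤ (((l i : ℕ) : ℝ) + 1) * sideLength M n := h2
      _ ≤ (((((l i : ℕ) / D : ℕ) : ℝ) + 1) * D) * sideLength M n := by gcongr
      _ = _ := by ring

end Ancestors

/-- `c` is a possible realization of the construction. -/
structure IsCantorTree {d : ℕ} {M : ℕ → ℕ} (N : ℕ → ℕ)
    (c : (n : ℕ) → Finset (CubeIdx d M n)) : Prop where
  level_zero : c 0 = Finset.univ
  exists_parent : ∀ n, ∀ l ∈ c (n + 1), ∃ j ∈ c n, l ∈ children j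
  card_chosen : ∀ n, ∀ j ∈ c n, (c (n + 1) ∩ children j).card = N n

theorem IsRandomCantor.isCantorTree {Ω : Type*} [MeasurableSpace Ω] {Pr : Measure Ω} {d : ℕ}
    {M N : ℕ → ℕ} {C : (n : ℕ) → Ω → Finset (CubeIdx d M n)} (hC : IsRandomCantor Pr d M N C)
    (ω : Ω) : IsCantorTree N fun n => C n ω :=
  ⟨hC.level_zero ω, fun n => hC.exists_parent n ω, fun n => hC.card_chosen n ω⟩

namespace IsCantorTree

variable {d : ℕ} {M N : ℕ → ℕ} {c : (n : ℕ) → Finset (CubeIdx d M n)}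

theorem ancestor_mem (hc : IsCantorTree N c) {m n : ℕ} (h : m ≤ n) {l : CubeIdx d M n}
    (hl : l ∈ c n) : ancestor h l ∈ c m := by
  induction n, h using Nat.le_induction with
  | base => rwa [ancestor_self]
  | succ n h ih =>
    obtain ⟨j, hj, hlj⟩ := hc.exists_parent n l hl
    rw [mem_children_iff] at hlj
    rw [← ancestor_ancestor h n.le_succ, hlj]
    exact ih hj

theorem card_descendants (hc : IsCantorTree N c) {m n : ℕ} (h : m ≤ n) {j : CubeIdx d M m}
    (hj : j ∈ c m) :
    ((c n).filter fun l => ancestor h l = j).card = ∏ i ∈ Finset.Ico m n, N i := by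
  induction n, h using Nat.le_induction with
  | base =>
    simp only [ancestor_self, Finset.filter_eq', hj, if_true]
    simp
  | succ n h ih =>
    rw [Finset.prod_Ico_succ_top h, ← ih,
      Finset.card_eq_sum_card_fiberwise (f := ancestor n.le_succ)
        (t := (c n).filter fun l => ancestor h l = j)]
    · rw [Finset.sum_const_nat (m := N n)]
      intro j' hj'
      rw [Finset.mem_filter] at hj'
      rw [← hc.card_chosen n j' hj'.1]
      congr 1
      ext l
      simp only [Finset.mem_filter, Finset.mem_inter, mem_children_iff]
      constructor
      · rintro ⟨⟨h1, -⟩, h2⟩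
        exact ⟨h1, h2⟩
      · rintro ⟨h1, h2⟩
        refine ⟨⟨h1, ?_⟩, h2⟩
        rw [← ancestor_ancestor h n.le_succ, h2, hj'.2]
    · intro l hl
      simp only [Finset.coe_filter, Set.mem_ofPred_eq] at hl ⊢
      exact ⟨hc.ancestor_mem n.le_succ hl.1, by rw [ancestor_ancestor, hl.2]⟩

theorem card_level (hc : IsCantorTree N c) (n : ℕ) : (c n).card = numChosen N n := by
  induction n with
  | zero => rw [hc.level_zero]; simp [numChosen]; exact Or.inl (Fintype.card_fin 1)
  | succ n ih =>
    rw [numChosen_succ, ← ih, Finset.card_eq_sum_card_fiberwise (f := ancestor n.le_succ)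
        (t := c n) fun l hl => hc.ancestor_mem n.le_succ hl, Finset.sum_const_nat (m := N n)]
    intro j hj
    rw [← hc.card_chosen n j hj]
    congr 1
    ext l
    simp [mem_children_iff]

end IsCantorTree

/-! ### Geometry of adic cubes. -/

section Cubes

variable {d : ℕ} {M : ℕ → ℕ}

theorem unitCube_eq_adicCube (j : CubeIdx d M 0) : unitCube d = adicCube j := by
  ext x
  have h (i : Fin d) : ((j i : ℕ) : ℝ) = 0 := by
    have : (j i : ℕ) < 1 := by simpa using (j i).2
    exact_mod_cast Nat.lt_one_iff.1 this
  simp [unitCube, adicCube, h, sideLength]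

theorem exists_mem_adicCube (hM : ∀ n, 2 ≤ M n) (n : ℕ) {x : EuclideanSpace ℝ (Fin d)}
    (hx : x ∈ unitCube d) : ∃ j : CubeIdx d M n, x ∈ adicCube j := by
  have hpos := prod_range_pos hM n
  have hr := sideLength_pos hM n
  have hmul := sideLength_mul_prod_range hM n
  set q := ∏ i ∈ Finset.range n, M i with hq
  have hq' : (0 : ℝ) < q := by exact_mod_cast hpos
  have key (i : Fin d) : ∃ a : Fin q, (a : ℝ) * sideLength M n ≤ x i ∧
      x i ≤ ((a : ℝ) + 1) * sideLength M n := by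
    obtain ⟨h0, h1⟩ := hx i
    -- At x_i = 1 the floor of x_i q is q, one past the last index, so the last interval is taken
    -- instead.
    rcases h1.eq_or_lt with h1 | h1
    · refine ⟨⟨q - 1, by omega⟩, ?_, ?_⟩
      · have : ((q - 1 : ℕ) : ℝ) = q - 1 := by push_cast [Nat.cast_sub hpos]; ring
        simp only [this]
        nlinarith
      · have : ((q - 1 : ℕ) : ℝ) = q - 1 := by push_cast [Nat.cast_sub hpos]; ring
        simp only [this]
        nlinarith
    · have hfl : ⌊x i * q⌋₊ < q := (Nat.floor_lt (by positivity)).2 (by nlinarith)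
      refine ⟨⟨_, hfl⟩, ?_, ?_⟩
      · have := Nat.floor_le (show 0 ≤ x i * q by positivity)
        calc _ ≤ x i * q * sideLength M n := by gcongr
          _ = x i := by linear_combination x i * hmul
      · have := (Nat.lt_floor_add_one (x i * q)).le
        calc x i = x i * q * sideLength M n := by linear_combination -(x i) * hmul
          _ ≤ _ := by gcongr
  choose a ha using key
  exact ⟨a, ha⟩

theorem dist_le_of_mem_adicCube (hM : ∀ n, 2 ≤ M n) {n : ℕ} {j : CubeIdx d M n}
    {x y : EuclideanSpace ℝ (Fin d)} (hx : x ∈ adicCube j) (hy : y ∈ adicCube j) :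
    dist x y ≤ √d * sideLength M n := by
  have hr := (sideLength_pos hM n).le
  rw [EuclideanSpace.dist_eq, Real.sqrt_le_left (by positivity), mul_pow,
    Real.sq_sqrt (Nat.cast_nonneg d)]
  calc ∑ i, dist (x i) (y i) ^ 2 ≤ ∑ _i : Fin d, sideLength M n ^ 2 := by
        refine Finset.sum_le_sum fun i _ => ?_
        have h1 := hx i
        have h2 := hy i
        have : dist (x i) (y i) ≤ sideLength M n := by
          rw [Real.dist_eq, abs_le]
          constructor <;> linarith [h1.1, h1.2, h2.1, h2.2]
        gcongr
    _ = _ := by simp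

theorem isClosed_adicCube {n : ℕ} (j : CubeIdx d M n) : IsClosed (adicCube j) := by
  simp only [adicCube, Set.ofPred_forall]
  refine isClosed_iInter fun i => ?_
  have hc : Continuous fun x : EuclideanSpace ℝ (Fin d) => x i := by fun_prop
  exact (isClosed_le continuous_const hc).inter (isClosed_le hc continuous_const)

theorem isCompact_unitCube (d : ℕ) : IsCompact (unitCube d) := by
  have h : IsCompact (Set.pi Set.univ fun _ : Fin d => Set.Icc (0 : ℝ) 1) :=
    isCompact_univ_pi fun _ => isCompact_Icc
  convert h.image (PiLp.continuous_toLp 2 fun _ : Fin d => ℝ) using 1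
  ext x
  simp only [unitCube, Set.mem_ofPred_eq, Set.mem_image, Set.mem_univ_pi, Set.mem_Icc]
  exact ⟨fun hx => ⟨x.ofLp, hx, rfl⟩, by rintro ⟨y, hy, rfl⟩; exact hy⟩

end Cubes

/-! ### Natural measures on unions of cubes, and uniqueness. -/

/-- The mass that a natural measure gives to a cube. -/
def cubeMass {d : ℕ} {M : ℕ → ℕ} (N : ℕ → ℕ) (c : (n : ℕ) → Finset (CubeIdx d M n)) {n : ℕ}
    (j : CubeIdx d M n) : ℝ≥0∞ :=
  if j ∈ c n then ((numChosen N n : ℝ≥0∞))⁻¹ else 0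

theorem sum_cubeMass {d : ℕ} {M : ℕ → ℕ} (N : ℕ → ℕ) (c : (n : ℕ) → Finset (CubeIdx d M n)) {n : ℕ}
    (S : Finset (CubeIdx d M n)) :
    ∑ j ∈ S, cubeMass N c j = ((c n ∩ S).card : ℝ≥0∞) * ((numChosen N n : ℝ≥0∞))⁻¹ := by
  simp [cubeMass, Finset.inter_comm]

section NaturalMeasure

variable {d : ℕ} {M N : ℕ → ℕ} {c : (n : ℕ) → Finset (CubeIdx d M n)}

theorem IsCantorTree.sum_cubeMass_univ (hc : IsCantorTree N c) (hN : ∀ n, 1 ≤ N n) (n : ℕ) :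
    ∑ j : CubeIdx d M n, cubeMass N c j = 1 := by
  rw [sum_cubeMass, Finset.inter_univ, hc.card_level]
  exact ENNReal.mul_inv_cancel (by exact_mod_cast (numChosen_pos hN n).ne') (by simp)

theorem IsNaturalMeasure.measure_unitCube {μ : Measure (EuclideanSpace ℝ (Fin d))}
    (hμ : IsNaturalMeasure N c μ) (hc : IsCantorTree N c) : μ (unitCube d) = 1 := by
  rw [unitCube_eq_adicCube (M := M) fun _ => ⟨0, by simp⟩, hμ.2, hc.level_zero,
    if_pos (Finset.mem_univ _)]
  simp [numChosen]

theorem IsNaturalMeasure.isProbabilityMeasure {μ : Measure (EuclideanSpace ℝ (Fin d))}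
    (hμ : IsNaturalMeasure N c μ) (hc : IsCantorTree N c) : IsProbabilityMeasure μ := by
  constructor
  refine le_antisymm ?_ ((hμ.measure_unitCube hc).symm.le.trans (measure_mono (Set.subset_univ _)))
  rw [← Set.union_compl_self (unitCube d)]
  exact (measure_union_le _ _).trans (by rw [hμ.measure_unitCube hc, hμ.1, add_zero])

theorem IsNaturalMeasure.measure_biUnion_le {μ : Measure (EuclideanSpace ℝ (Fin d))}
    (hμ : IsNaturalMeasure N c μ) {n : ℕ} (S : Finset (CubeIdx d M n)) :
    μ (⋃ j ∈ S, adicCube j) ≤ ∑ j ∈ S, cubeMass N c j :=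
  (measure_biUnion_finset_le _ _).trans (Finset.sum_le_sum fun j _ => (hμ.2 n j).le)

/-- Subadditivity gives one inequality, although the cubes overlap on faces. Applied to the
complementary cubes it gives the other, since all the cube masses together sum to 1, the mass of the
unit cube. -/
theorem IsNaturalMeasure.measure_biUnion {μ : Measure (EuclideanSpace ℝ (Fin d))}
    (hμ : IsNaturalMeasure N c μ) (hc : IsCantorTree N c) (hM : ∀ n, 2 ≤ M n) (hN : ∀ n, 1 ≤ N n)
    {n : ℕ} (S : Finset (CubeIdx d M n)) :
    μ (⋃ j ∈ S, adicCube j) = ∑ j ∈ S, cubeMass N c j := by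
  refine le_antisymm (hμ.measure_biUnion_le S) ?_
  have h1 : (1 : ℝ≥0∞) ≤ μ (⋃ j ∈ S, adicCube j) + ∑ j ∈ Sᶜ, cubeMass N c j := by
    rw [← hμ.measure_unitCube hc]
    refine le_trans ?_ (add_le_add_right (hμ.measure_biUnion_le Sᶜ) _)
    refine le_trans (measure_mono ?_) (measure_union_le _ _)
    intro x hx
    obtain ⟨j, hj⟩ := exists_mem_adicCube hM n hx
    by_cases hjS : j ∈ S
    · exact Or.inl (Set.mem_biUnion hjS hj)
    · exact Or.inr (Set.mem_biUnion (Finset.mem_coe.2 (Finset.mem_compl.2 hjS)) hj)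
  rw [← hc.sum_cubeMass_univ hN n, ← Finset.sum_add_sum_compl S] at h1
  refine (ENNReal.add_le_add_iff_right ?_).1 h1
  refine ne_top_of_le_ne_top ENNReal.one_ne_top ?_
  rw [← hc.sum_cubeMass_univ hN n]
  exact Finset.sum_le_univ_sum_of_nonneg fun _ => zero_le

/-- Both measures agree on the union of the level-n cubes that meet F. That union covers F inside
the unit cube and lies in the √d r_n-thickening of F, which shrinks to F as n grows. -/
theorem IsNaturalMeasure.measure_isClosed_le {μ ν : Measure (EuclideanSpace ℝ (Fin d))}
    (hμ : IsNaturalMeasure N c μ) (hν : IsNaturalMeasure N c ν) (hc : IsCantorTree N c)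
    (hM : ∀ n, 2 ≤ M n) (hN : ∀ n, 1 ≤ N n) {F : Set (EuclideanSpace ℝ (Fin d))}
    (hF : IsClosed F) : ν F ≤ μ F := by
  classical
  have := hμ.isProbabilityMeasure hc
  have hlim : Filter.Tendsto (fun n => μ (Metric.cthickening (√d * sideLength M n) F))
      Filter.atTop (nhds (μ F)) := by
    refine (tendsto_measure_cthickening_of_isClosed ⟨1, one_pos, measure_ne_top _ _⟩ hF).comp ?_
    simpa using (tendsto_sideLength hM).const_mul √d
  refine ge_of_tendsto' hlim fun n => ?_
  let S : Finset (CubeIdx d M n) := Finset.univ.filter fun j => (adicCube j ∩ F).Nonempty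
  calc ν F ≤ ν ((⋃ j ∈ S, adicCube j) ∪ (unitCube d)ᶜ) := by
        refine measure_mono fun x hx => ?_
        by_cases hxu : x ∈ unitCube d
        · obtain ⟨j, hj⟩ := exists_mem_adicCube hM n hxu
          exact Or.inl (Set.mem_biUnion
            (Finset.mem_coe.2 (Finset.mem_filter.2 ⟨Finset.mem_univ _, x, hj, hx⟩)) hj)
        · exact Or.inr hxu
    _ ≤ ν (⋃ j ∈ S, adicCube j) + ν (unitCube d)ᶜ := measure_union_le _ _
    _ = μ (⋃ j ∈ S, adicCube j) := by
        rw [hν.1, add_zero, hν.measure_biUnion hc hM hN, hμ.measure_biUnion hc hM hN]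
    _ ≤ _ := by
        refine measure_mono (Set.iUnion₂_subset fun j hj x hx => ?_)
        obtain ⟨y, hy, hyF⟩ := (Finset.mem_filter.1 hj).2
        exact Metric.mem_cthickening_of_dist_le x y _ F hyF (dist_le_of_mem_adicCube hM hx hy)

theorem IsNaturalMeasure.unique {μ ν : Measure (EuclideanSpace ℝ (Fin d))}
    (hμ : IsNaturalMeasure N c μ) (hν : IsNaturalMeasure N c ν) (hc : IsCantorTree N c)
    (hM : ∀ n, 2 ≤ M n) (hN : ∀ n, 1 ≤ N n) : ν = μ := by
  have := hμ.isProbabilityMeasure hc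
  have := hν.isProbabilityMeasure hc
  refine ext_of_generate_finite _ ?_ isPiSystem_isClosed (fun F hF => ?_) (by simp)
  · rw [BorelSpace.measurable_eq (α := EuclideanSpace ℝ (Fin d)), borel_eq_generateFrom_isClosed]
  · exact le_antisymm (hμ.measure_isClosed_le hν hc hM hN hF) (hν.measure_isClosed_le hμ hc hM hN hF)

end NaturalMeasure

/-! ### Existence of the natural measure when slabs carry vanishing mass. -/

section Existence

variable {d : ℕ} {M : ℕ → ℕ}

/-- The corner with the smallest coordinates of an adic cube. -/
def corner {n : ℕ} (l : CubeIdx d M n) : EuclideanSpace ℝ (Fin d) :=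
  WithLp.toLp 2 fun i => ((l i : ℕ) : ℝ) * sideLength M n

theorem corner_mem_adicCube (hM : ∀ n, 2 ≤ M n) {n : ℕ} (l : CubeIdx d M n) :
    corner l ∈ adicCube l := by
  intro i
  have := sideLength_pos hM n
  simp only [corner]
  exact ⟨le_rfl, by gcongr; linarith⟩

theorem corner_mem_unitCube (hM : ∀ n, 2 ≤ M n) {n : ℕ} (l : CubeIdx d M n) :
    corner l ∈ unitCube d := by
  rw [unitCube_eq_adicCube (ancestor (Nat.zero_le n) l)]
  exact adicCube_subset_adicCube_ancestor hM _ _ (corner_mem_adicCube hM l)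

/-- The share of the chosen cubes of level `m` that are close to the hyperplane `x_i = y`. -/
def slabMass (N : ℕ → ℕ) (c : (n : ℕ) → Finset (CubeIdx d M n)) (i : Fin d) (y : ℝ) (m : ℕ) :
    ℝ≥0∞ :=
  (((c m).filter fun l => |((l i : ℕ) : ℝ) * sideLength M m - y| ≤ 2 * sideLength M m).card : ℝ≥0∞)
    * ((numChosen N m : ℝ≥0∞))⁻¹

/-- The uniform distribution on the corners of the chosen cubes of level `n`. -/
def cornerMeasure (N : ℕ → ℕ) (c : (n : ℕ) → Finset (CubeIdx d M n)) (n : ℕ) :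
    Measure (EuclideanSpace ℝ (Fin d)) :=
  ((numChosen N n : ℝ≥0∞))⁻¹ • ∑ l ∈ c n, Measure.dirac (corner l)

variable {N : ℕ → ℕ} {c : (n : ℕ) → Finset (CubeIdx d M n)}

open Classical in
theorem cornerMeasure_apply {n : ℕ} {A : Set (EuclideanSpace ℝ (Fin d))} (hA : MeasurableSet A) :
    cornerMeasure N c n A =
      ((numChosen N n : ℝ≥0∞))⁻¹ * (((c n).filter fun l => corner l ∈ A).card : ℝ≥0∞) := by
  simp [cornerMeasure, Measure.dirac_apply' _ hA, Set.indicator_apply]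

theorem IsCantorTree.isProbabilityMeasure_cornerMeasure (hc : IsCantorTree N c)
    (hN : ∀ n, 1 ≤ N n) (n : ℕ) : IsProbabilityMeasure (cornerMeasure N c n) := by
  constructor
  rw [cornerMeasure_apply MeasurableSet.univ]
  simp only [Set.mem_univ, Finset.filter_true, hc.card_level]
  exact ENNReal.inv_mul_cancel (by exact_mod_cast (numChosen_pos hN n).ne') (by simp)

theorem numChosen_inv_mul_prod_Ico (hN : ∀ n, 1 ≤ N n) {m n : ℕ} (h : m ≤ n) :
    ((numChosen N n : ℝ≥0∞))⁻¹ * ((∏ i ∈ Finset.Ico m n, N i : ℕ) : ℝ≥0∞)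
      = ((numChosen N m : ℝ≥0∞))⁻¹ := by
  have hI : 0 < ∏ i ∈ Finset.Ico m n, N i := Finset.prod_pos fun i _ => hN i
  rw [numChosen_eq_mul_prod_Ico N h, Nat.cast_mul, ENNReal.mul_inv (Or.inr (ENNReal.natCast_ne_top _)) (Or.inl (ENNReal.natCast_ne_top _)), mul_assoc,
    ENNReal.inv_mul_cancel (by exact_mod_cast hI.ne') (ENNReal.natCast_ne_top _), mul_one]

/-- Only an inequality holds: corners of neighbouring chosen cubes may also lie on the faces of the
closed cube. -/
theorem IsCantorTree.cubeMass_le_cornerMeasure (hc : IsCantorTree N c) (hM : ∀ n, 2 ≤ M n)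
    (hN : ∀ n, 1 ≤ N n) {m n : ℕ} (h : m ≤ n) (j : CubeIdx d M m) :
    cubeMass N c j ≤ cornerMeasure N c n (adicCube j) := by
  classical
  rw [cornerMeasure_apply (isClosed_adicCube j).measurableSet, cubeMass]
  split_ifs with hj
  · rw [← numChosen_inv_mul_prod_Ico hN h, ← hc.card_descendants h hj]
    gcongr _ * (Nat.cast ?_)
    refine Finset.card_le_card fun l hl => ?_
    rw [Finset.mem_filter] at hl ⊢
    refine ⟨hl.1, ?_⟩
    rw [← hl.2]
    exact adicCube_subset_adicCube_ancestor hM _ _ (corner_mem_adicCube hM _)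
  · exact zero_le

/-- A corner within r_m of the hyperplane has a level-m ancestor whose own corner is within 2 r_m of
it, and every chosen ancestor has the same number of chosen descendants. -/
theorem IsCantorTree.cornerMeasure_slab_le (hc : IsCantorTree N c) (hM : ∀ n, 2 ≤ M n)
    (hN : ∀ n, 1 ≤ N n) {m n : ℕ} (h : m ≤ n) (i : Fin d) (y : ℝ) :
    cornerMeasure N c n {x | |x i - y| < sideLength M m} ≤ slabMass N c i y m := by
  classical
  have hmeas : MeasurableSet {x : EuclideanSpace ℝ (Fin d) | |x i - y| < sideLength M m} := by
    refine (isOpen_lt ?_ continuous_const).measurableSet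
    fun_prop
  rw [cornerMeasure_apply hmeas, slabMass, ← numChosen_inv_mul_prod_Ico hN h, mul_left_comm]
  gcongr
  rw [← Nat.cast_mul, Nat.cast_le, mul_comm]
  refine Finset.card_le_mul_card_image_of_maps_to (f := ancestor h) (fun l hl => ?_) _ fun j hj => ?_
  · rw [Finset.mem_filter] at hl ⊢
    refine ⟨hc.ancestor_mem h hl.1, ?_⟩
    have h1 := adicCube_subset_adicCube_ancestor hM h l (corner_mem_adicCube hM l) i
    have h2 := hl.2
    simp only [Set.mem_ofPred_eq, abs_lt] at h2
    rw [abs_le]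
    constructor <;> linarith [h1.1, h1.2, h2.1, h2.2]
  · rw [← hc.card_descendants h (Finset.mem_filter.1 hj).1]
    refine Finset.card_le_card fun l hl => ?_
    simp only [Finset.mem_filter] at hl ⊢
    exact ⟨hl.1.1, hl.2⟩

theorem adicCube_inter_subset (j j' : CubeIdx d M n) (hjj' : j ≠ j') (hM : ∀ n, 2 ≤ M n) :
    ∃ (i : Fin d) (a : ℕ), adicCube j ∩ adicCube j' ⊆ {x | x i = a * sideLength M n} := by
  obtain ⟨i, hi⟩ := Function.ne_iff.1 hjj'
  have hr := sideLength_pos hM n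
  refine ⟨i, max (j i) (j' i), fun x ⟨hx, hx'⟩ => ?_⟩
  have h1 := hx i
  have h2 := hx' i
  rcases lt_or_gt_of_ne (Fin.val_ne_of_ne hi) with h | h
  · rw [max_eq_right h.le]
    have : ((j i : ℕ) : ℝ) + 1 ≤ ((j' i : ℕ) : ℝ) := by exact_mod_cast h
    exact le_antisymm (h1.2.trans (by gcongr)) h2.1
  · rw [max_eq_left h.le]
    have : ((j' i : ℕ) : ℝ) + 1 ≤ ((j i : ℕ) : ℝ) := by exact_mod_cast h
    exact le_antisymm (h2.2.trans (by gcongr)) h1.1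

/-- In a weak limit, closed cubes have at least the prescribed mass. The slab hypothesis prevents
mass from sitting on a common face, where it would be counted for several cubes; the total mass 1
then forces equality. -/
theorem IsCantorTree.exists_isNaturalMeasure (hc : IsCantorTree N c) (hM : ∀ n, 2 ≤ M n)
    (hN : ∀ n, 1 ≤ N n)
    (hslab : ∀ (i : Fin d) (p a : ℕ),
      Filter.Tendsto (slabMass N c i (a * sideLength M p)) Filter.atTop (nhds 0)) :
    ∃ μ, IsNaturalMeasure N c μ := by
  let μs : ℕ → ProbabilityMeasure (EuclideanSpace ℝ (Fin d)) := fun n =>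
    ⟨cornerMeasure N c n, hc.isProbabilityMeasure_cornerMeasure hN n⟩
  -- Compactness of the probability measures carried by the unit cube gives a limit along an
  -- ultrafilter, so no subsequence has to be extracted.
  let U := Filter.hyperfilter ℕ
  have hU : (U : Filter ℕ) ≤ Filter.atTop := Nat.hyperfilter_le_atTop
  have hcomp := isCompact_setOfPred_probabilityMeasure_mass_eq_compl_isCompact_le (u := fun _ => 0)
    (K := fun _ => unitCube d) tendsto_const_nhds (fun _ => isCompact_unitCube d)
    (Or.inl inferInstance)
  have hmem (n : ℕ) : μs n ∈ {μ : ProbabilityMeasure (EuclideanSpace ℝ (Fin d)) |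
      ∀ _ : ℕ, μ (unitCube d)ᶜ ≤ 0} := by
    intro _
    have : cornerMeasure N c n (unitCube d)ᶜ = 0 := by
      rw [cornerMeasure_apply (isCompact_unitCube d).isClosed.measurableSet.compl]
      simp [corner_mem_unitCube hM]
    simp [μs, this]
  obtain ⟨μ, hμ, hlim⟩ := hcomp.ultrafilter_le_nhds (U.map μs)
    (Filter.le_principal_iff.2 (Filter.Eventually.of_forall hmem : ∀ᶠ n in (U : Filter ℕ), _))
  have hlim' : Filter.Tendsto μs U (nhds μ) := hlim
  have hlow (n : ℕ) (j : CubeIdx d M n) : cubeMass N c j ≤ (μ : Measure _) (adicCube j) := by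
    refine le_trans ?_
      (ProbabilityMeasure.limsup_measure_closed_le_of_tendsto hlim' (isClosed_adicCube j))
    refine le_trans ?_ (Filter.liminf_le_limsup)
    exact Filter.le_liminf_of_le (by isBoundedDefault)
      (((Filter.eventually_ge_atTop n).filter_mono hU).mono fun m hm =>
        hc.cubeMass_le_cornerMeasure hM hN hm j)
  have hplane (i : Fin d) (p a : ℕ) :
      (μ : Measure _) {x : EuclideanSpace ℝ (Fin d) | x i = a * sideLength M p} = 0 := by
    refine le_antisymm (ge_of_tendsto' (hslab i p a) fun m => ?_) zero_le
    have hopen : IsOpen {x : EuclideanSpace ℝ (Fin d) |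
        |x i - a * sideLength M p| < sideLength M m} := by
      refine isOpen_lt ?_ continuous_const
      fun_prop
    refine (measure_mono (t := {x : EuclideanSpace ℝ (Fin d) |
      |x i - a * sideLength M p| < sideLength M m}) fun x hx => ?_).trans
      ((ProbabilityMeasure.le_liminf_measure_open_of_tendsto hlim' hopen).trans ?_)
    · have : x i = a * sideLength M p := hx
      simp [this, sideLength_pos hM m]
    · refine Filter.liminf_le_of_le (by isBoundedDefault) fun b hb => ?_
      obtain ⟨n, hbn, hn⟩ := (hb.and ((Filter.eventually_ge_atTop m).filter_mono hU)).exists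
      exact hbn.trans (hc.cornerMeasure_slab_le hM hN hn i _)
  refine ⟨μ, ?_, fun n j => ?_⟩
  · have := hμ 0
    simpa [ProbabilityMeasure.coeFn_def, ENNReal.toNNReal_eq_zero_iff] using this
  -- Grid hyperplanes being null, the cubes are almost disjoint and their masses sum to at most 1.
  -- Together with the termwise lower bound this leaves no slack.
  have hsum : ∑ j : CubeIdx d M n, (μ : Measure _) (adicCube j)
      ≤ ∑ j : CubeIdx d M n, cubeMass N c j := by
    rw [hc.sum_cubeMass_univ hN, ← measure_biUnion_finset₀ _
      fun j _ => (isClosed_adicCube j).measurableSet.nullMeasurableSet]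
    · exact prob_le_one
    · intro j _ j' _ hjj'
      obtain ⟨i, a, h⟩ := adicCube_inter_subset j j' hjj' hM
      exact measure_mono_null h (hplane i n a)
  have hfin : ∑ j : CubeIdx d M n, cubeMass N c j ≠ ⊤ := by simp [hc.sum_cubeMass_univ hN]
  refine le_antisymm ?_ (hlow n j)
  rw [← Finset.add_sum_erase _ _ (Finset.mem_univ j), ← Finset.add_sum_erase _ _ (Finset.mem_univ j)]
    at hsum
  rw [← Finset.add_sum_erase _ _ (Finset.mem_univ j)] at hfin
  refine (ENNReal.add_le_add_iff_right (ENNReal.add_ne_top.1 hfin).2).1 (le_trans ?_ hsum)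
  gcongr with j'
  exact hlow n j'

end Existence

/-! ### First moments of slabs. -/

theorem card_le_of_abs_sub_le (T : Finset ℕ) (x : ℝ) (R : ℕ) (h : ∀ a ∈ T, |(a : ℝ) - x| ≤ R) :
    T.card ≤ 2 * R + 1 := by
  have hsub : T.map Nat.castEmbedding ⊆ Finset.Icc ⌈x - R⌉ ⌊x + R⌋ := by
    intro z hz
    obtain ⟨a, ha, rfl⟩ := Finset.mem_map.1 hz
    have := abs_le.1 (h a ha)
    rw [Finset.mem_Icc, Int.ceil_le, Int.le_floor]
    simp only [Nat.castEmbedding_apply, Int.cast_natCast]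
    constructor <;> linarith
  have hcard := Finset.card_le_card hsub
  rw [Finset.card_map, Int.card_Icc] at hcard
  refine hcard.trans ?_
  have h1 := Int.floor_le (x + R)
  have h2 := Int.le_ceil (x - R)
  have h3 : ((⌊x + R⌋ + 1 - ⌈x - R⌉ : ℤ) : ℝ) ≤ ((2 * R + 1 : ℤ) : ℝ) := by push_cast; linarith
  have h4 : ⌊x + R⌋ + 1 - ⌈x - R⌉ ≤ 2 * R + 1 := by exact_mod_cast h3
  omega

section Slabs

variable {d : ℕ} {M : ℕ → ℕ}

/-- The i-th index lies within 2 of y / r_m, hence takes at most 5 values; the other d - 1 indices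
are free. -/
theorem card_slab_le (hM : ∀ n, 2 ≤ M n) (m : ℕ) (i : Fin d) (y : ℝ) :
    (Finset.univ.filter fun l : CubeIdx d M m =>
      |((l i : ℕ) : ℝ) * sideLength M m - y| ≤ 2 * sideLength M m).card
      ≤ 5 * (∏ i ∈ Finset.range m, M i) ^ (d - 1) := by
  have hr := sideLength_pos hM m
  set q := ∏ i ∈ Finset.range m, M i with hq
  let T : Finset (Fin q) := Finset.univ.filter fun a =>
    |(a : ℝ) * sideLength M m - y| ≤ 2 * sideLength M m
  have hT : T.card ≤ 5 := by
    rw [← Finset.card_map Fin.valEmbedding]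
    refine card_le_of_abs_sub_le _ (y / sideLength M m) 2 fun a ha => ?_
    obtain ⟨a, haT, rfl⟩ := Finset.mem_map.1 ha
    have h := (Finset.mem_filter.1 haT).2
    have h' : |(a : ℝ) - y / sideLength M m| * sideLength M m ≤ 2 * sideLength M m := by
      calc _ = |(a : ℝ) * sideLength M m - y| := by
            nth_rw 2 [← abs_of_pos hr]
            rw [← abs_mul, sub_mul, div_mul_cancel₀ _ hr.ne']
        _ ≤ _ := h
    exact le_of_mul_le_mul_right (by simpa using h') hr
  calc _ ≤ (Fintype.piFinset
        (Function.update (fun _ : Fin d => (Finset.univ : Finset (Fin q))) i T)).card := by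
        refine Finset.card_le_card fun l hl => ?_
        rw [Fintype.mem_piFinset]
        intro i'
        by_cases h : i' = i
        · subst h
          simpa [T] using (Finset.mem_filter.1 hl).2
        · simp [Function.update_of_ne h]
    _ = T.card * q ^ (d - 1) := by
        rw [Fintype.card_piFinset, ← Finset.mul_prod_erase _ _ (Finset.mem_univ i),
          Function.update_self, Finset.prod_congr rfl (g := fun _ => q)]
        · simp
        · intro i' hi'
          rw [Function.update_of_ne (Finset.ne_of_mem_erase hi')]
          simp
    _ ≤ _ := by gcongr

end Slabs

namespace IsRandomCantor

variable {Ω : Type*} [MeasurableSpace Ω] {Pr : Measure Ω} {d : ℕ} {M N : ℕ → ℕ}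
  {C : (n : ℕ) → Ω → Finset (CubeIdx d M n)}

theorem measurable_level (hC : IsRandomCantor Pr d M N C) (n : ℕ) : Measurable[_, ⊤] (C n) := by
  intro s _
  have : C n ⁻¹' s = ⋃ e ∈ s, {ω | C n ω = e} := by ext; simp
  rw [this]
  exact MeasurableSet.biUnion (Set.to_countable s) fun e _ => hC.measurableSet_eq n e

theorem measurable_comp_level (hC : IsRandomCantor Pr d M N C) (n : ℕ) {β : Type*}
    [MeasurableSpace β] (F : Finset (CubeIdx d M n) → β) : Measurable fun ω => F (C n ω) :=
  measurable_from_top.comp (hC.measurable_level n)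

theorem measurableSet_mem (hC : IsRandomCantor Pr d M N C) {n : ℕ} (l : CubeIdx d M n) :
    MeasurableSet {ω | l ∈ C n ω} :=
  hC.measurable_level n (MeasurableSpace.measurableSet_top (s := {e | l ∈ e}))

theorem lintegral_sum_children (hC : IsRandomCantor Pr d M N C) {n : ℕ}
    {e : Finset (CubeIdx d M n)} (he : Pr {ω | C n ω = e} ≠ 0) {j : CubeIdx d M n} (hj : j ∈ e)
    (h : CubeIdx d M (n + 1) → ℝ≥0∞) :
    ∫⁻ ω, ∑ l ∈ C (n + 1) ω ∩ children j, h l ∂(ProbabilityTheory.cond Pr {ω | C n ω = e})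
      = (N n : ℝ≥0∞) / (M n : ℝ≥0∞) ^ d * ∑ l ∈ children j, h l := by
  have hF (ω : Ω) : ∑ l ∈ C (n + 1) ω ∩ children j, h l
      = ∑ l ∈ children j, {ω | l ∈ C (n + 1) ω}.indicator (fun _ => h l) ω := by
    rw [Finset.inter_comm, ← Finset.filter_mem_eq_inter, Finset.sum_filter]
    simp [Set.indicator_apply]
  simp_rw [hF]
  rw [lintegral_finsetSum _ fun l _ => measurable_const.indicator (hC.measurableSet_mem l),
    Finset.mul_sum]
  refine Finset.sum_congr rfl fun l hl => ?_
  rw [lintegral_indicator (hC.measurableSet_mem l), setLIntegral_const,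
    hC.prob_chosen n e he j hj l hl, mul_comm]

variable [IsProbabilityMeasure Pr]

theorem lintegral_eq_sum_cond (hC : IsRandomCantor Pr d M N C) (n : ℕ) (F : Ω → ℝ≥0∞) :
    ∫⁻ ω, F ω ∂Pr = ∑ e, Pr {ω | C n ω = e} *
      ∫⁻ ω, F ω ∂(ProbabilityTheory.cond Pr {ω | C n ω = e}) := by
  have hU : (⋃ e, {ω | C n ω = e}) = Set.univ := by ext; simp
  rw [← setLIntegral_univ, ← hU, lintegral_iUnion (hC.measurableSet_eq n), tsum_fintype]
  · refine Finset.sum_congr rfl fun e _ => ?_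
    rw [ProbabilityTheory.cond, lintegral_smul_measure, smul_eq_mul, ← mul_assoc]
    by_cases h : Pr {ω | C n ω = e} = 0
    · rw [h, Measure.restrict_eq_zero.2 h]
      simp
    · rw [ENNReal.mul_inv_cancel h (measure_ne_top _ _), one_mul]
  · intro e e' hee'
    refine Set.disjoint_left.2 fun ω h h' => hee' ?_
    exact (show C n ω = e from h).symm.trans h'

theorem prob_mem_succ (hC : IsRandomCantor Pr d M N C) {n : ℕ} (l : CubeIdx d M (n + 1)) :
    Pr {ω | l ∈ C (n + 1) ω}
      ≤ (N n : ℝ≥0∞) / (M n : ℝ≥0∞) ^ d * Pr {ω | ancestor n.le_succ l ∈ C n ω} := by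
  have hl : l ∈ children (ancestor n.le_succ l) := (mem_children_iff _ _).2 rfl
  have key (B : Set Ω) (hB : MeasurableSet B) : Pr B = ∑ e, Pr {ω | C n ω = e} *
      ProbabilityTheory.cond Pr {ω | C n ω = e} B := by
    simpa [lintegral_indicator_one hB] using hC.lintegral_eq_sum_cond n (B.indicator 1)
  rw [key _ (hC.measurableSet_mem l), key _ (hC.measurableSet_mem (ancestor n.le_succ l)),
    Finset.mul_sum]
  refine Finset.sum_le_sum fun e _ => ?_
  rw [mul_left_comm]
  by_cases he : Pr {ω | C n ω = e} = 0
  · simp [he]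
  gcongr
  have hself := ProbabilityTheory.cond_apply_self he (measure_ne_top _ _)
  by_cases hj : ancestor n.le_succ l ∈ e
  · rw [hC.prob_chosen n e he _ hj l hl]
    refine le_mul_of_one_le_right' ?_
    rw [← hself]
    refine measure_mono fun ω hω => ?_
    rw [Set.mem_ofPred_eq] at hω ⊢
    rwa [hω]
  · rw [ProbabilityTheory.cond_apply (hC.measurableSet_eq n e)]
    have : {ω | C n ω = e} ∩ {ω | l ∈ C (n + 1) ω} = ∅ := by
      refine Set.eq_empty_of_forall_notMem fun ω ⟨h1, h2⟩ => hj ?_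
      rw [← (show C n ω = e from h1)]
      exact (hC.isCantorTree ω).ancestor_mem n.le_succ h2
    simp [this]

theorem prob_mem_le (hC : IsRandomCantor Pr d M N C) {n : ℕ} (l : CubeIdx d M n) :
    Pr {ω | l ∈ C n ω} ≤ ∏ i ∈ Finset.range n, (N i : ℝ≥0∞) / (M i : ℝ≥0∞) ^ d := by
  induction n with
  | zero => simpa using prob_le_one
  | succ n ih =>
    rw [Finset.prod_range_succ, mul_comm]
    exact (hC.prob_mem_succ l).trans (by gcongr; exact ih _)

/-- Each of the at most 5 q^(d-1) slab cubes is chosen with probability at most P_m/q^d, where q =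
r_m⁻¹. Dividing by P_m leaves 5/q. -/
theorem lintegral_slabMass_le (hC : IsRandomCantor Pr d M N C) (hM : ∀ n, 2 ≤ M n)
    (hN : ∀ n, 1 ≤ N n) (i : Fin d) (y : ℝ) (m : ℕ) :
    ∫⁻ ω, slabMass N (fun n => C n ω) i y m ∂Pr ≤ 5 * (2⁻¹ : ℝ≥0∞) ^ m := by
  let S := Finset.univ.filter fun l : CubeIdx d M m =>
      |((l i : ℕ) : ℝ) * sideLength M m - y| ≤ 2 * sideLength M m
  have hF (ω : Ω) : slabMass N (fun n => C n ω) i y m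
      = (∑ l ∈ S, {ω | l ∈ C m ω}.indicator 1 ω) * ((numChosen N m : ℝ≥0∞))⁻¹ := by
    rw [slabMass]
    congr 1
    simp only [Set.indicator_apply, Set.mem_ofPred_eq, Pi.one_apply, Finset.sum_boole, S,
      Finset.filter_filter]
    congr 2
    ext l
    simp [and_comm]
  have hd : d - 1 + 1 = d := Nat.sub_add_cancel (Nat.one_le_of_lt i.2)
  have hq := prod_range_pos hM m
  have hP := numChosen_pos hN m
  have hprod : ∏ i ∈ Finset.range m, (N i : ℝ≥0∞) / (M i : ℝ≥0∞) ^ d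
      = (numChosen N m : ℝ≥0∞) / ((∏ i ∈ Finset.range m, M i : ℕ) : ℝ≥0∞) ^ d := by
    simp only [div_eq_mul_inv, Finset.prod_mul_distrib, numChosen, Nat.cast_prod,
      ← Finset.prod_pow]
    rw [ENNReal.prod_inv_distrib]
    intro a _ b _ _
    right
    simp
  have hside : ((∏ i ∈ Finset.range m, M i : ℕ) : ℝ≥0∞)⁻¹ ≤ 2⁻¹ ^ m := by
    rw [← ENNReal.inv_pow, ENNReal.inv_le_inv]
    have : 2 ^ m ≤ ∏ i ∈ Finset.range m, M i := by
      simpa using Finset.prod_le_prod' fun i (_ : i ∈ Finset.range m) => hM i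
    exact_mod_cast this
  simp_rw [hF]
  rw [lintegral_mul_const _ (Finset.measurable_sum _ fun l _ =>
      measurable_one.indicator (hC.measurableSet_mem l)),
    lintegral_finsetSum _ fun l _ => measurable_one.indicator (hC.measurableSet_mem l)]
  simp_rw [lintegral_indicator_one (hC.measurableSet_mem _)]
  set q := ∏ i ∈ Finset.range m, M i
  have hq0 : (q : ℝ≥0∞) ≠ 0 := by exact_mod_cast hq.ne'
  calc _ ≤ (∑ l ∈ S, (numChosen N m : ℝ≥0∞) / (q : ℝ≥0∞) ^ d) * ((numChosen N m : ℝ≥0∞))⁻¹ := by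
        gcongr
        rw [← hprod]
        exact hC.prob_mem_le _
    _ = (S.card : ℝ≥0∞) * ((q : ℝ≥0∞) ^ d)⁻¹ := by
        rw [Finset.sum_const, nsmul_eq_mul, mul_assoc, div_eq_mul_inv, mul_right_comm,
          ENNReal.mul_inv_cancel (by exact_mod_cast hP.ne') (by simp), one_mul]
    _ ≤ ((5 * q ^ (d - 1) : ℕ) : ℝ≥0∞) * ((q : ℝ≥0∞) ^ d)⁻¹ := by
        gcongr
        exact card_slab_le hM m i y
    _ = 5 * (q : ℝ≥0∞)⁻¹ := by
        nth_rw 2 [← hd]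
        rw [pow_succ, ENNReal.mul_inv (by simp) (by simp)]
        push_cast
        rw [mul_assoc, ← mul_assoc ((q : ℝ≥0∞) ^ (d - 1)),
          ENNReal.mul_inv_cancel (pow_ne_zero _ hq0) (by simp), one_mul]
    _ ≤ _ := by gcongr

theorem ae_tendsto_slabMass (hC : IsRandomCantor Pr d M N C) (hM : ∀ n, 2 ≤ M n)
    (hN : ∀ n, 1 ≤ N n) : ∀ᵐ ω ∂Pr, ∀ (i : Fin d) (p a : ℕ),
      Filter.Tendsto (slabMass N (fun n => C n ω) i (a * sideLength M p)) Filter.atTop (nhds 0) := by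
  simp_rw [ae_all_iff]
  intro i p a
  have hmeas (m : ℕ) : Measurable fun ω => slabMass N (fun n => C n ω) i (a * sideLength M p) m :=
    hC.measurable_comp_level m fun e => ((e.filter fun l =>
      |((l i : ℕ) : ℝ) * sideLength M m - a * sideLength M p| ≤ 2 * sideLength M m).card : ℝ≥0∞)
        * ((numChosen N m : ℝ≥0∞))⁻¹
  have hfin : ∫⁻ ω, ∑' m, slabMass N (fun n => C n ω) i (a * sideLength M p) m ∂Pr ≠ ⊤ := by
    rw [lintegral_tsum fun m => (hmeas m).aemeasurable]
    refine ne_top_of_le_ne_top ?_ (ENNReal.tsum_le_tsum fun m =>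
      hC.lintegral_slabMass_le hM hN i (a * sideLength M p) m)
    rw [ENNReal.tsum_mul_left, ENNReal.tsum_geometric, ENNReal.one_sub_inv_two, inv_inv]
    exact ENNReal.mul_ne_top (by simp) (by simp)
  filter_upwards [ae_lt_top (Measurable.tsum hmeas) hfin] with ω hω
  exact ENNReal.tendsto_atTop_zero_of_tsum_ne_top hω.ne

end IsRandomCantor

/-! ### Exponential moments along the tree. -/

theorem exp_le_one_add_mul {x b : ℝ} (hx : 0 ≤ x) (hxb : x ≤ b) (hb : b ≤ 1) :
    Real.exp x ≤ 1 + (1 + b) * x := by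
  have h := Real.abs_exp_sub_one_sub_id_le (x := x) (by rw [abs_of_nonneg hx]; linarith)
  have := (abs_le.1 h).2
  nlinarith

namespace IsRandomCantor

variable {Ω : Type*} [MeasurableSpace Ω] {Pr : Measure Ω} {d : ℕ} {M N : ℕ → ℕ}
  {C : (n : ℕ) → Ω → Finset (CubeIdx d M n)}

theorem sum_level_succ_eq (hC : IsRandomCantor Pr d M N C) {n : ℕ}
    (h : CubeIdx d M (n + 1) → ℝ) (ω : Ω) :
    ∑ l ∈ C (n + 1) ω, h l = ∑ j ∈ C n ω, ∑ l ∈ C (n + 1) ω ∩ children j, h l := by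
  rw [← Finset.sum_fiberwise_of_maps_to (g := ancestor n.le_succ) (t := C n ω)
    fun l hl => (hC.isCantorTree ω).ancestor_mem n.le_succ hl]
  refine Finset.sum_congr rfl fun j _ => Finset.sum_congr ?_ fun _ _ => rfl
  ext l
  simp [mem_children_iff]

variable [IsProbabilityMeasure Pr]

/-- Exponential moments of additive functionals decrease, up to a small factor in the exponent,
when one passes from level `n + 1` to conditional expectations at level `n`. -/
theorem lintegral_exp_level_succ_le (hC : IsRandomCantor Pr d M N C) (hM : ∀ n, 2 ≤ M n) {n : ℕ}
    {b : ℝ} (hb : b ≤ 1) {h : CubeIdx d M (n + 1) → ℝ} (h0 : ∀ l, 0 ≤ h l)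
    (hsum : ∀ ω, ∀ j ∈ C n ω, ∑ l ∈ C (n + 1) ω ∩ children j, h l ≤ b) (hb0 : 0 ≤ b) :
    ∫⁻ ω, ENNReal.ofReal (Real.exp (∑ l ∈ C (n + 1) ω, h l)) ∂Pr ≤
      ∫⁻ ω, ENNReal.ofReal (Real.exp (∑ j ∈ C n ω,
        (1 + b) * ((N n : ℝ) / (M n : ℝ) ^ d) * ∑ l ∈ children j, h l)) ∂Pr := by
  rw [hC.lintegral_eq_sum_cond n, hC.lintegral_eq_sum_cond n]
  refine Finset.sum_le_sum fun e _ => ?_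
  by_cases he : Pr {ω | C n ω = e} = 0
  · simp [he]
  gcongr _ * ?_
  have := ProbabilityTheory.cond_isProbabilityMeasure he
  have hmem := ProbabilityTheory.ae_cond_mem (μ := Pr) (hC.measurableSet_eq n e)
  set κ := ProbabilityTheory.cond Pr {ω | C n ω = e} with hκ
  have hratio : ENNReal.ofReal ((N n : ℝ) / (M n : ℝ) ^ d) = (N n : ℝ≥0∞) / (M n : ℝ≥0∞) ^ d := by
    have : (0 : ℝ) < M n := by exact_mod_cast (by have := hM n; omega : 0 < M n)
    rw [ENNReal.ofReal_div_of_pos (by positivity), ENNReal.ofReal_pow this.le]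
    simp
  -- Given level n, the exponential splits into independent factors, one per chosen cube. Each is
  -- linearized by `exp_le_one_add_mul`, averaged using the common marginal probability, and turned
  -- back into an exponential by 1 + x ≤ e^x.
  let X : {j // j ∈ e} → Ω → ℝ≥0∞ := fun j ω =>
    ENNReal.ofReal (Real.exp (∑ l ∈ C (n + 1) ω ∩ children j.1, h l))
  have hXmeas (j : {j // j ∈ e}) : Measurable (X j) :=
    hC.measurable_comp_level (n + 1) fun s =>
      ENNReal.ofReal (Real.exp (∑ l ∈ s ∩ children j.1, h l))
  have hXindep : ProbabilityTheory.iIndepFun X κ :=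
    (hC.indep_chosen n e he).comp (mγ := fun _ => inferInstance)
      (fun _ s => ENNReal.ofReal (Real.exp (∑ l ∈ s, h l))) fun _ => measurable_from_top
  have hleft : ∫⁻ ω, ENNReal.ofReal (Real.exp (∑ l ∈ C (n + 1) ω, h l)) ∂κ
      = ∏ j : {j // j ∈ e}, ∫⁻ ω, X j ω ∂κ := by
    rw [← ProbabilityTheory.lintegral_prod_eq_prod_lintegral_of_indepFun _ X hXindep hXmeas]
    refine lintegral_congr_ae (hmem.mono fun ω hω => ?_)
    simp only [X]
    rw [hC.sum_level_succ_eq, show C n ω = e from hω, Real.exp_sum, ENNReal.ofReal_prod_of_nonneg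
      fun _ _ => (Real.exp_pos _).le, Finset.prod_coe_sort e fun j =>
      ENNReal.ofReal (Real.exp (∑ l ∈ C (n + 1) ω ∩ children j, h l))]
  have hright : ∫⁻ ω, ENNReal.ofReal (Real.exp (∑ j ∈ C n ω,
        (1 + b) * ((N n : ℝ) / (M n : ℝ) ^ d) * ∑ l ∈ children j, h l)) ∂κ
      = ∏ j : {j // j ∈ e}, ENNReal.ofReal (Real.exp
        ((1 + b) * ((N n : ℝ) / (M n : ℝ) ^ d) * ∑ l ∈ children j.1, h l)) := by
    rw [lintegral_congr_ae (g := fun _ => ENNReal.ofReal (Real.exp (∑ j ∈ e,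
        (1 + b) * ((N n : ℝ) / (M n : ℝ) ^ d) * ∑ l ∈ children j, h l)))
        (hmem.mono fun ω hω => by simp only [show C n ω = e from hω]),
      lintegral_const, measure_univ, mul_one, Real.exp_sum, ENNReal.ofReal_prod_of_nonneg
      fun _ _ => (Real.exp_pos _).le, ← Finset.prod_coe_sort e]
  rw [hleft, hright]
  refine Finset.prod_le_prod' fun j _ => ?_
  calc ∫⁻ ω, X j ω ∂κ
      ≤ ∫⁻ ω, (1 + ENNReal.ofReal (1 + b) *
          ∑ l ∈ C (n + 1) ω ∩ children j.1, ENNReal.ofReal (h l)) ∂κ := by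
        refine lintegral_mono_ae (hmem.mono fun ω hω => ?_)
        have hs0 : 0 ≤ ∑ l ∈ C (n + 1) ω ∩ children j.1, h l := Finset.sum_nonneg fun l _ => h0 l
        rw [← ENNReal.ofReal_sum_of_nonneg fun l _ => h0 l, ← ENNReal.ofReal_one,
          ← ENNReal.ofReal_mul (by linarith), ← ENNReal.ofReal_add zero_le_one (by positivity)]
        refine ENNReal.ofReal_le_ofReal (exp_le_one_add_mul hs0 (hsum ω j.1 ?_) hb)
        rw [show C n ω = e from hω]
        exact j.2
    _ = 1 + ENNReal.ofReal (1 + b) * ((N n : ℝ≥0∞) / (M n : ℝ≥0∞) ^ d *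
          ∑ l ∈ children j.1, ENNReal.ofReal (h l)) := by
        rw [lintegral_add_left measurable_const, lintegral_const_mul _
          (hC.measurable_comp_level (n + 1) fun s => ∑ l ∈ s ∩ children j.1, ENNReal.ofReal (h l)),
          hC.lintegral_sum_children he j.2]
        simp
    _ = ENNReal.ofReal (1 + (1 + b) * ((N n : ℝ) / (M n : ℝ) ^ d) * ∑ l ∈ children j.1, h l) := by
        have hs0 : 0 ≤ ∑ l ∈ children j.1, h l := Finset.sum_nonneg fun l _ => h0 l
        rw [← ENNReal.ofReal_sum_of_nonneg fun l _ => h0 l, ← hratio,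
          ← ENNReal.ofReal_mul (by positivity), ← ENNReal.ofReal_mul (by linarith),
          ← ENNReal.ofReal_one, ← ENNReal.ofReal_add zero_le_one (by positivity), mul_assoc]
    _ ≤ _ := by
        refine ENNReal.ofReal_le_ofReal ?_
        rw [add_comm]
        exact Real.add_one_le_exp _

theorem lintegral_exp_level_le (hC : IsRandomCantor Pr d M N C) (hM : ∀ n, 2 ≤ M n) {n : ℕ}
    {b : ℝ} (hb : b ≤ 1) (hb0 : 0 ≤ b) (g : (m : ℕ) → CubeIdx d M m → ℝ)
    (h0 : ∀ m l, 0 ≤ g m l)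
    (hsum : ∀ ω, ∀ m < n, ∀ j ∈ C m ω, ∑ l ∈ C (m + 1) ω ∩ children j, g (m + 1) l ≤ b)
    (hrec : ∀ m < n, ∀ j : CubeIdx d M m,
      (1 + b) * ((N m : ℝ) / (M m : ℝ) ^ d) * ∑ l ∈ children j, g (m + 1) l ≤ g m j) :
    ∫⁻ ω, ENNReal.ofReal (Real.exp (∑ l ∈ C n ω, g n l)) ∂Pr
      ≤ ENNReal.ofReal (Real.exp (∑ l, g 0 l)) := by
  have key (m : ℕ) (hm : m ≤ n) : ∫⁻ ω, ENNReal.ofReal (Real.exp (∑ l ∈ C m ω, g m l)) ∂Pr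
      ≤ ENNReal.ofReal (Real.exp (∑ l, g 0 l)) := by
    induction m with
    | zero => simp [hC.level_zero]
    | succ m ih =>
      refine le_trans ?_ (ih (Nat.le_of_succ_le hm))
      refine (hC.lintegral_exp_level_succ_le hM hb (h0 (m + 1)) (fun ω => hsum ω m hm) hb0).trans ?_
      refine lintegral_mono fun ω => ENNReal.ofReal_le_ofReal (Real.exp_le_exp.2 ?_)
      exact Finset.sum_le_sum fun j _ => hrec m hm j
  exact key n le_rfl

end IsRandomCantor

/-! ### Planes as graphs, and their discretization by tubes. -/

/-- Every linear subspace is a graph over some of the coordinates, with coefficients at most `1`. -/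
theorem exists_graph_coefficients {d q : ℕ} (V : Submodule ℝ (EuclideanSpace ℝ (Fin d)))
    (hV : Module.finrank ℝ V = q) :
    ∃ (e : Fin q → Fin d) (b : Fin d → Fin q → ℝ), (∀ j i, |b j i| ≤ 1) ∧
      ∀ v ∈ V, ∀ j, v j = ∑ i, b j i * v (e i) := by
  classical
  let φ : Fin d → Module.Dual ℝ V := fun j =>
    (EuclideanSpace.proj j : EuclideanSpace ℝ (Fin d) →L[ℝ] ℝ).toLinearMap ∘ₗ V.subtype
  have hφ (j : Fin d) (v : V) : φ j v = (v : EuclideanSpace ℝ (Fin d)) j := rfl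
  -- Coordinate functionals separate the points of V, so they span its dual.
  have hspan : Submodule.span ℝ (Set.range φ) = ⊤ := by
    refine Submodule.span_eq_top_of_ne_zero fun z hz => ?_
    by_contra! h
    refine hz (Subtype.ext ?_)
    ext j
    exact h _ ⟨j, rfl⟩
  obtain ⟨f, hfmem, hfspan, hfli⟩ := Submodule.exists_fun_fin_finrank_span_eq ℝ (Set.range φ)
  have hfin : Module.finrank ℝ (Submodule.span ℝ (Set.range φ)) = q := by
    rw [hspan, finrank_top, Subspace.dual_finrank_eq, hV]
  revert f
  rw [hfin]
  intro f hfmem hfspan hfli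
  choose e₀ he₀ using hfmem
  rw [hspan] at hfspan
  let β := Module.Basis.mk hfli hfspan.ge
  -- The pivot coordinates maximize the absolute determinant over all q-tuples of coordinate
  -- functionals. By Cramer's rule each graph coefficient is a ratio of such a determinant to the
  -- maximal one, hence at most 1 in absolute value.
  obtain ⟨e, -, hmax⟩ := Finset.exists_max_image (Finset.univ : Finset (Fin q → Fin d))
    (fun e => |β.det (φ ∘ e)|) ⟨e₀, Finset.mem_univ _⟩
  have hdet₀ : β.det (φ ∘ e₀) = 1 := by
    have : φ ∘ e₀ = β := by
      ext1 i
      simp [β, he₀]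
    rw [this, Module.Basis.det_self]
  have hdet : β.det (φ ∘ e) ≠ 0 := by
    have := hmax e₀ (Finset.mem_univ _)
    rw [hdet₀, abs_one] at this
    exact abs_pos.1 (zero_lt_one.trans_le this)
  obtain ⟨hli, hsp⟩ := (Module.Basis.is_basis_iff_det β).2 (isUnit_iff_ne_zero.2 hdet)
  let γ := Module.Basis.mk hli hsp.ge
  refine ⟨e, fun j i => γ.repr (φ j) i, fun j i => ?_, fun v hv j => ?_⟩
  · have h := congrArg (fun L => L (φ j)) (β.det_smul_mk_coord_eq_det_update hli hsp.ge i)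
    have h' : β.det (φ ∘ e) * γ.repr (φ j) i = β.det (φ ∘ Function.update e i j) := by
      rw [Function.comp_update]
      exact h
    have hle := hmax (Function.update e i j) (Finset.mem_univ _)
    rw [← h', abs_mul] at hle
    exact le_of_mul_le_mul_left (by simpa using hle) (abs_pos.2 hdet)
  · have h := congrArg (fun L => L ⟨v, hv⟩) (γ.sum_repr (φ j))
    simpa [γ, hφ] using h.symm

section Tubes

variable {d q : ℕ} {M : ℕ → ℕ}

/-- The cube with index `l` is close to the plane `x_j = r_n A_j + ∑ i, r_n B_{ji} x_{e i}`. -/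
def IsTubeCube {n : ℕ} (R : ℕ) (p : (Fin q → Fin d) × (Fin d → ℤ) × (Fin d → Fin q → ℤ))
    (l : CubeIdx d M n) : Prop :=
  ∀ j, |((l j : ℕ) : ℝ) - (p.2.1 j + ∑ i, p.2.2 j i * (sideLength M n * ((l (p.1 i) : ℕ) : ℝ)))| ≤ R

/-- A finite set of parameters that describes all planes at level `n`. -/
def tubeParams (d q : ℕ) (M : ℕ → ℕ) (n : ℕ) :
    Finset ((Fin q → Fin d) × (Fin d → ℤ) × (Fin d → Fin q → ℤ)) :=
  let I := Finset.Icc (-((q + 2) * ∏ i ∈ Finset.range n, M i : ℕ) : ℤ)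
    ((q + 2) * ∏ i ∈ Finset.range n, M i : ℕ)
  Finset.univ ×ˢ (Fintype.piFinset fun _ => I) ×ˢ
    (Fintype.piFinset fun _ => Fintype.piFinset fun _ => I)

theorem card_tubeParams (d q : ℕ) (M : ℕ → ℕ) (n : ℕ) :
    (tubeParams d q M n).card = d ^ q *
      (2 * ((q + 2) * ∏ i ∈ Finset.range n, M i) + 1) ^ (d + d * q) := by
  have (K : ℕ) : (Finset.Icc (-K : ℤ) K).card = 2 * K + 1 := by
    rw [Int.card_Icc]
    omega
  simp only [tubeParams, Finset.card_product, Fintype.card_piFinset, this, Finset.prod_const,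
    Finset.card_univ, Fintype.card_fin, Fintype.card_fun]
  ring

-- Inside j each of the q free coordinates takes at most D values, and once they are fixed every
-- coordinate is confined to 2R + 1 values. This holds for arbitrary parameters, even if the free
-- coordinates repeat.
open Classical in
theorem card_tubeCubes_le (hM : ∀ n, 2 ≤ M n) (R : ℕ) {m n : ℕ} (h : m ≤ n)
    (p : (Fin q → Fin d) × (Fin d → ℤ) × (Fin d → Fin q → ℤ)) (j : CubeIdx d M m) :
    (Finset.univ.filter fun l : CubeIdx d M n => IsTubeCube R p l ∧ ancestor h l = j).card
      ≤ (2 * R + 1) ^ d * (∏ i ∈ Finset.Ico m n, M i) ^ q := by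
  have hDpos := prod_Ico_pos hM m n
  set D := ∏ i ∈ Finset.Ico m n, M i with hD
  let J : Fin q → Finset (Fin (∏ i ∈ Finset.range n, M i)) := fun i =>
    Finset.univ.filter fun a => (a : ℕ) / D = j (p.1 i)
  have hJ (i : Fin q) : (J i).card ≤ D := by
    rw [← Finset.card_map Fin.valEmbedding]
    refine (Finset.card_le_card (t := Finset.Ico (j (p.1 i) * D) (j (p.1 i) * D + D))
      fun a ha => ?_).trans (by simp)
    obtain ⟨a, haJ, rfl⟩ := Finset.mem_map.1 ha
    have h1 := (Finset.mem_filter.1 haJ).2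
    rw [Finset.mem_Ico, ← h1]
    exact ⟨Nat.div_mul_le_self _ _, Nat.lt_div_mul_add hDpos⟩
  calc _ ≤ (2 * R + 1) ^ d * (Fintype.piFinset J).card := by
        refine Finset.card_le_mul_card_image_of_maps_to (f := fun l i => l (p.1 i))
          (fun l hl => ?_) _ fun f _ => ?_
        · rw [Finset.mem_filter] at hl
          refine Fintype.mem_piFinset.2 fun i => Finset.mem_filter.2 ⟨Finset.mem_univ _, ?_⟩
          rw [← hl.2.2]
          rfl
        · let T : Fin d → Finset (Fin (∏ i ∈ Finset.range n, M i)) := fun i' =>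
            Finset.univ.filter fun a =>
              |((a : ℕ) : ℝ) - (p.2.1 i' + ∑ i, p.2.2 i' i * (sideLength M n * ((f i : ℕ) : ℝ)))| ≤ R
          have hT (i' : Fin d) : (T i').card ≤ 2 * R + 1 := by
            rw [← Finset.card_map Fin.valEmbedding]
            refine card_le_of_abs_sub_le _
              (p.2.1 i' + ∑ i, p.2.2 i' i * (sideLength M n * ((f i : ℕ) : ℝ))) R fun a ha => ?_
            obtain ⟨a, haT, rfl⟩ := Finset.mem_map.1 ha
            exact (Finset.mem_filter.1 haT).2
          refine (Finset.card_le_card (t := Fintype.piFinset T) fun l hl => ?_).trans ?_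
          · rw [Finset.mem_filter, Finset.mem_filter] at hl
            refine Fintype.mem_piFinset.2 fun i' => Finset.mem_filter.2 ⟨Finset.mem_univ _, ?_⟩
            rw [← hl.2]
            exact hl.1.2.1 i'
          · rw [Fintype.card_piFinset]
            exact (Finset.prod_le_prod' fun i' _ => hT i').trans (by simp)
    _ ≤ _ := by
        gcongr
        rw [Fintype.card_piFinset]
        exact (Finset.prod_le_prod' fun i _ => hJ i).trans (by simp)

theorem exists_tubeParams (hM : ∀ n, 2 ≤ M n) {n : ℕ}
    {W : AffineSubspace ℝ (EuclideanSpace ℝ (Fin d))} (hW : W ∈ planesMeetingCube d q) {δ : ℝ}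
    (hδ : δ ≤ sideLength M n) :
    ∃ p ∈ tubeParams d q M n, ∀ l : CubeIdx d M n, (adicCube l ∩ strip W δ).Nonempty →
      IsTubeCube (3 + 3 * q) p l := by
  obtain ⟨hrank, w₀, hw₀W, hw₀⟩ := hW
  obtain ⟨e, b, hb, hgraph⟩ := exists_graph_coefficients W.direction hrank
  have hr := sideLength_pos hM n
  have hrq := sideLength_mul_prod_range hM n
  have hQ1 : 1 ≤ ∏ i ∈ Finset.range n, M i := prod_range_pos hM n
  set r := sideLength M n with hrdef
  set Q := ∏ i ∈ Finset.range n, M i with hQ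
  have hQ1' : (1 : ℝ) ≤ Q := by exact_mod_cast hQ1
  have hrinv : r⁻¹ = Q := inv_eq_of_mul_eq_one_right hrq
  -- The plane is x_j = a_j + ∑ b_ji x_(e i). As it passes through a point of the unit cube, |a_j| ≤
  -- 1 + q, which is why the box of parameters can be bounded independently of the plane.
  let a : Fin d → ℝ := fun j => w₀ j - ∑ i, b j i * w₀ (e i)
  have hsum (f g : Fin q → ℝ) (s : ℝ) (hf : ∀ i, |f i| ≤ 1) (hg : ∀ i, |g i| ≤ s) :
      |∑ i, f i * g i| ≤ q * s := by
    calc |∑ i, f i * g i| ≤ ∑ i, |f i * g i| := Finset.abs_sum_le_sum_abs _ _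
      _ ≤ ∑ _i : Fin q, s := Finset.sum_le_sum fun i _ => by
          rw [abs_mul]
          calc |f i| * |g i| ≤ 1 * s :=
                mul_le_mul (hf i) (hg i) (abs_nonneg _) zero_le_one
            _ = s := one_mul s
      _ = q * s := by simp
  have ha (j : Fin d) : |a j| ≤ 1 + q := by
    have h1 : |w₀ j| ≤ 1 := abs_le.2 ⟨by linarith [(hw₀ j).1], (hw₀ j).2⟩
    have h2 := hsum (b j) (fun i => w₀ (e i)) 1 (hb j) fun i =>
      abs_le.2 ⟨by linarith [(hw₀ (e i)).1], (hw₀ (e i)).2⟩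
    calc |a j| ≤ |w₀ j| + |∑ i, b j i * w₀ (e i)| := abs_sub _ _
      _ ≤ 1 + q := by linarith
  have hW (w) (hw : w ∈ W) (j : Fin d) : w j = a j + ∑ i, b j i * w (e i) := by
    have h := hgraph (w - w₀) (AffineSubspace.vsub_mem_direction hw hw₀W) j
    simp only [PiLp.sub_apply, mul_sub, Finset.sum_sub_distrib] at h
    simp only [a]
    linarith
  have hfloor (x : ℝ) (hx : |x| ≤ 1 + q) :
      ⌊x / r⌋ ∈ Finset.Icc (-((q + 2) * Q : ℕ) : ℤ) ((q + 2) * Q : ℕ) := by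
    have h1 := abs_le.1 hx
    rw [Finset.mem_Icc, Int.le_floor, div_eq_mul_inv, hrinv]
    constructor
    · push_cast
      nlinarith
    · refine Int.floor_le_iff.2 ?_
      push_cast
      nlinarith
  have hround (x : ℝ) : |x - ⌊x / r⌋ * r| ≤ r := by
    have h1 := Int.floor_le (x / r)
    have h2 := (Int.lt_floor_add_one (x / r)).le
    rw [le_div_iff₀ hr] at h1
    rw [div_le_iff₀ hr] at h2
    rw [abs_le]
    constructor <;> linarith
  refine ⟨(e, fun j => ⌊a j / r⌋, fun j i => ⌊b j i / r⌋), ?_, ?_⟩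
  · simp only [tubeParams, Finset.mem_product, Fintype.mem_piFinset, Finset.mem_univ, true_and]
    exact ⟨fun j => hfloor _ (ha j), fun j i => hfloor _ ((hb j i).trans (by simp))⟩
  · rintro l ⟨x, hxl, hxS⟩ j
    obtain ⟨w, hwW, hxw⟩ := (Metric.infDist_lt_iff ⟨w₀, hw₀W⟩).1 hxS
    have hlw (j : Fin d) : |((l j : ℕ) : ℝ) * r - w j| ≤ 2 * r := by
      have h1 : |x j - w j| ≤ r := by
        calc |x j - w j| = ‖(x - w) j‖ := by simp
          _ ≤ ‖x - w‖ := PiLp.norm_apply_le _ _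
          _ = dist x w := (dist_eq_norm _ _).symm
          _ ≤ r := by linarith
      have h2 := hxl j
      have h3 := abs_le.1 h1
      rw [abs_le]
      constructor <;> linarith [h2.1, h2.2]
    have hl1 (j : Fin d) : |((l j : ℕ) : ℝ) * r| ≤ 1 := by
      have : ((l j : ℕ) : ℝ) ≤ Q := by exact_mod_cast (l j).2.le
      rw [abs_of_nonneg (by positivity)]
      nlinarith
    refine le_of_mul_le_mul_right ?_ hr
    calc |((l j : ℕ) : ℝ) - (⌊a j / r⌋ + ∑ i, ⌊b j i / r⌋ * (r * ((l (e i) : ℕ) : ℝ)))| * r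
        = |(((l j : ℕ) : ℝ) * r - w j) + (a j - ⌊a j / r⌋ * r)
            - ∑ i, b j i * (((l (e i) : ℕ) : ℝ) * r - w (e i))
            + ∑ i, (((l (e i) : ℕ) : ℝ) * r) * (b j i - ⌊b j i / r⌋ * r)| := by
          rw [show ∀ y : ℝ, |y| * r = |y * r| from fun y => by rw [abs_mul, abs_of_pos hr], hW w hwW j]
          congr 1
          simp only [mul_sub, Finset.sum_sub_distrib, sub_mul, add_mul, Finset.sum_mul]
          have h1 : ∑ i, b j i * (((l (e i) : ℕ) : ℝ) * r) = ∑ i, ((l (e i) : ℕ) : ℝ) * r * b j i :=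
            Finset.sum_congr rfl fun i _ => by ring
          have h2 : ∑ i, (⌊b j i / r⌋ : ℝ) * (r * ((l (e i) : ℕ) : ℝ)) * r
              = ∑ i, ((l (e i) : ℕ) : ℝ) * r * (⌊b j i / r⌋ * r) :=
            Finset.sum_congr rfl fun i _ => by ring
          rw [h1, h2]
          ring
      -- The four errors are: from corner to plane in coordinate j, rounding of a, from corner to
      -- plane in the free coordinates, and rounding of b. Their sum is (3 + 3q) r.
      _ ≤ 2 * r + r + q * (2 * r) + q * r := by
          refine (abs_add_le _ _).trans (add_le_add ((abs_sub _ _).trans (add_le_add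
            ((abs_add_le _ _).trans (add_le_add (hlw j) (hround _))) ?_)) ?_)
          · exact hsum _ _ _ (hb j) fun i => hlw (e i)
          · exact hsum _ _ _ (fun i => hl1 (e i)) fun i => hround _
      _ = _ := by push_cast; ring

end Tubes

/-! ### Weights propagated from the tube cubes to the root. -/

section TubeWeight

variable {d q k : ℕ} {M N : ℕ → ℕ}

open Classical in
/-- The number of tube cubes of level `n` inside the cube with index `j` of level `m`. -/
def tubeCount (n R : ℕ) (p : (Fin q → Fin d) × (Fin d → ℤ) × (Fin d → Fin q → ℤ)) (m : ℕ)
    (j : CubeIdx d M m) : ℕ :=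
  (Finset.univ.filter fun l : CubeIdx d M n =>
    IsTubeCube R p l ∧ ∀ i, (l i : ℕ) / ∏ i ∈ Finset.Ico m n, M i = j i).card

-- The count is defined by division rather than through `ancestor`, so that it exists for every m
-- and can serve as a family of weights indexed by all levels.
open Classical in
theorem tubeCount_eq {n R m : ℕ} (h : m ≤ n)
    (p : (Fin q → Fin d) × (Fin d → ℤ) × (Fin d → Fin q → ℤ)) (j : CubeIdx d M m) :
    tubeCount n R p m j =
      (Finset.univ.filter fun l : CubeIdx d M n => IsTubeCube R p l ∧ ancestor h l = j).card := by
  simp [tubeCount, ancestor, funext_iff, Fin.ext_iff]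

open Classical in
theorem tubeCount_self {n R : ℕ} (p : (Fin q → Fin d) × (Fin d → ℤ) × (Fin d → Fin q → ℤ))
    (l : CubeIdx d M n) : tubeCount n R p n l = if IsTubeCube R p l then 1 else 0 := by
  rw [tubeCount_eq le_rfl]
  simp only [ancestor_self]
  split_ifs with h
  · rw [Finset.card_eq_one]
    exact ⟨l, by ext l'; simp only [Finset.mem_filter, Finset.mem_univ, true_and,
      Finset.mem_singleton, and_iff_right_iff_imp]; rintro rfl; exact h⟩
  · rw [Finset.card_eq_zero]
    refine Finset.filter_eq_empty_iff.2 fun l' _ h' => h ?_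
    rw [← h'.2]
    exact h'.1

theorem sum_tubeCount_children {n R m : ℕ} (h : m < n)
    (p : (Fin q → Fin d) × (Fin d → ℤ) × (Fin d → Fin q → ℤ)) (j : CubeIdx d M m) :
    ∑ l ∈ children j, tubeCount n R p (m + 1) l = tubeCount n R p m j := by
  classical
  rw [tubeCount_eq h.le, Finset.card_eq_sum_card_fiberwise
    (f := ancestor (Nat.succ_le_of_lt h)) (t := children j)]
  · refine Finset.sum_congr rfl fun l hl => ?_
    rw [tubeCount_eq (Nat.succ_le_of_lt h), Finset.filter_filter]
    congr 1
    ext l'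
    simp only [Finset.mem_filter, Finset.mem_univ, true_and, ancestor_succ_eq_iff h]
    constructor
    · rintro ⟨h1, rfl⟩
      exact ⟨⟨h1, hl⟩, rfl⟩
    · rintro ⟨⟨h1, -⟩, h2⟩
      exact ⟨h1, h2⟩
  · intro l hl
    have := (Finset.mem_filter.1 hl).2.2
    exact (ancestor_succ_eq_iff h j l).1 this

/-- The exponents in the exponential moment estimate: conditional expectations of
`θ` times the number of chosen tube cubes of level `n`, inflated by a factor `1 + b` at each step. -/
def tubeWeight (N : ℕ → ℕ) (n R : ℕ) (p : (Fin q → Fin d) × (Fin d → ℤ) × (Fin d → Fin q → ℤ))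
    (θ b : ℝ) (m : ℕ) (j : CubeIdx d M m) : ℝ :=
  θ * (1 + b) ^ (n - m) * (∏ i ∈ Finset.Ico m n, (N i : ℝ) / (M i : ℝ) ^ d) * tubeCount n R p m j

theorem tubeWeight_rec {n R m : ℕ} (h : m < n)
    (p : (Fin q → Fin d) × (Fin d → ℤ) × (Fin d → Fin q → ℤ)) (θ b : ℝ) (j : CubeIdx d M m) :
    (1 + b) * ((N m : ℝ) / (M m : ℝ) ^ d) * ∑ l ∈ children j, tubeWeight N n R p θ b (m + 1) l
      = tubeWeight N n R p θ b m j := by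
  simp only [tubeWeight]
  rw [← Finset.mul_sum, ← Nat.cast_sum, sum_tubeCount_children h,
    Finset.prod_eq_prod_Ico_succ_bot h, show n - m = n - (m + 1) + 1 by omega, pow_succ]
  ring

theorem tubeWeight_nonneg {n R m : ℕ} (p : (Fin q → Fin d) × (Fin d → ℤ) × (Fin d → Fin q → ℤ))
    {θ b : ℝ} (hθ : 0 ≤ θ) (hb : 0 ≤ b) (j : CubeIdx d M m) : 0 ≤ tubeWeight N n R p θ b m j := by
  unfold tubeWeight
  have : 0 ≤ ∏ i ∈ Finset.Ico m n, (N i : ℝ) / (M i : ℝ) ^ d :=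
    Finset.prod_nonneg fun i _ => by positivity
  positivity

/-- With D = r_m/r_n, the count contributes D^q and the selection probabilities contribute D^(-d);
their product is D^(-k), the cost of codimension k. -/
theorem tubeWeight_le (hM : ∀ n, 2 ≤ M n) (hN : ∀ n, 1 ≤ N n) (hqk : q + k = d) {n R m : ℕ}
    (h : m ≤ n) (p : (Fin q → Fin d) × (Fin d → ℤ) × (Fin d → Fin q → ℤ))
    {θ b : ℝ} (hθ : 0 ≤ θ) (hb : 0 ≤ b) (j : CubeIdx d M m) :
    tubeWeight N n R p θ b m j ≤ θ * (1 + b) ^ n * (2 * R + 1) ^ d *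
      ((numChosen N n / numChosen N m) * (sideLength M n / sideLength M m) ^ k) := by
  have hcount := card_tubeCubes_le hM R h p j
  rw [← tubeCount_eq] at hcount
  have hD : (0 : ℝ) < (∏ i ∈ Finset.Ico m n, M i : ℕ) := by exact_mod_cast prod_Ico_pos hM m n
  have hP : (0 : ℝ) < numChosen N m := by exact_mod_cast numChosen_pos hN m
  have hr := sideLength_pos hM n
  have hside : sideLength M n / sideLength M m = ((∏ i ∈ Finset.Ico m n, M i : ℕ) : ℝ)⁻¹ := by
    rw [sideLength_eq_mul_prod_Ico hM h]
    field_simp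
  have hnum : (numChosen N n : ℝ) / numChosen N m = (∏ i ∈ Finset.Ico m n, N i : ℕ) := by
    rw [numChosen_eq_mul_prod_Ico N h, Nat.cast_mul]
    field_simp
  have hprod : ∏ i ∈ Finset.Ico m n, (N i : ℝ) / (M i : ℝ) ^ d
      = (∏ i ∈ Finset.Ico m n, N i : ℕ) / ((∏ i ∈ Finset.Ico m n, M i : ℕ) : ℝ) ^ d := by
    rw [Finset.prod_div_distrib, Finset.prod_pow]
    push_cast
    rfl
  rw [hside, hnum, tubeWeight, hprod]
  set D := ∏ i ∈ Finset.Ico m n, M i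
  set Q := ∏ i ∈ Finset.Ico m n, N i
  calc θ * (1 + b) ^ (n - m) * ((Q : ℝ) / (D : ℝ) ^ d) * tubeCount n R p m j
      ≤ θ * (1 + b) ^ n * ((Q : ℝ) / (D : ℝ) ^ d) * (((2 * R + 1) ^ d * D ^ q : ℕ) : ℝ) := by
        gcongr
        · linarith
        · exact Nat.sub_le _ _
    _ = _ := by
        rw [← hqk, inv_pow, pow_add]
        push_cast
        field_simp

end TubeWeight

/-! ### Tail bound for one tube. -/

namespace IsRandomCantor

variable {Ω : Type*} [MeasurableSpace Ω] {Pr : Measure Ω} {d q k : ℕ} {M N : ℕ → ℕ}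
  {C : (n : ℕ) → Ω → Finset (CubeIdx d M n)} [IsProbabilityMeasure Pr]

open Classical in
theorem lintegral_exp_tube_le (hC : IsRandomCantor Pr d M N C) (hM : ∀ n, 2 ≤ M n)
    (hN : ∀ n, 1 ≤ N n) {B : ℕ} (hB : ∀ n, M n ≤ B) (hqk : q + k = d) {σ c₀ : ℝ} (hσ : σ ≤ k)
    (hc₀ : 0 < c₀) (hP : ∀ m, c₀ ≤ numChosen N m * sideLength M m ^ σ) {n R : ℕ}
    (p : (Fin q → Fin d) × (Fin d → ℤ) × (Fin d → Fin q → ℤ)) {θ b : ℝ} (hθ : 0 ≤ θ) (hb0 : 0 ≤ b)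
    (hb1 : b ≤ 1)
    (hsmall : θ * (1 + b) ^ n * (2 * R + 1) ^ d * (B ^ k / c₀ * (numChosen N n *
      sideLength M n ^ σ)) ≤ b) :
    ∫⁻ ω, ENNReal.ofReal (Real.exp (θ * ((C n ω).filter (IsTubeCube R p)).card)) ∂Pr
      ≤ ENNReal.ofReal (Real.exp (θ * (1 + b) ^ n * (2 * R + 1) ^ d *
        (numChosen N n * sideLength M n ^ k))) := by
  have h := hC.lintegral_exp_level_le hM hb1 hb0 (n := n)
    (fun m => tubeWeight N n R p θ b m) (fun m l => tubeWeight_nonneg p hθ hb0 l) ?_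
    (fun m hm j => (tubeWeight_rec hm p θ b j).le)
  · refine (Eq.le ?_).trans (h.trans (ENNReal.ofReal_le_ofReal (Real.exp_le_exp.2 ?_)))
    · refine lintegral_congr fun ω => ?_
      simp only [tubeWeight, tubeCount_self]
      rw [← Finset.mul_sum]
      simp
    · have hcard : Fintype.card (CubeIdx d M 0) = 1 := by
        rw [Fintype.card_fun, Fintype.card_fin]
        simp
      calc _ ≤ ∑ _l : CubeIdx d M 0, θ * (1 + b) ^ n * (2 * R + 1) ^ d *
            ((numChosen N n / numChosen N 0) * (sideLength M n / sideLength M 0) ^ k) :=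
            Finset.sum_le_sum fun l _ => tubeWeight_le hM hN hqk (Nat.zero_le n) p hθ hb0 l
        _ = _ := by
            rw [Finset.sum_const, Finset.card_univ, hcard]
            simp [numChosen, sideLength]
  · intro ω m hm j hj
    have hPm : (0 : ℝ) < numChosen N m := by exact_mod_cast numChosen_pos hN m
    have hPn : (0 : ℝ) < numChosen N n := by exact_mod_cast numChosen_pos hN n
    have hNm : (0 : ℝ) < N m := by exact_mod_cast hN m
    have hMm : (0 : ℝ) < M m := by exact_mod_cast (by have := hM m; omega : 0 < M m)
    have hrm := sideLength_pos hM m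
    have hrn := sideLength_pos hM n
    have hBm : (M m : ℝ) ≤ B := by exact_mod_cast hB m
    -- The N_m chosen children turn P_(m+1) into P_m, and replacing r_(m+1) by r_m costs M_m^k ≤
    -- B^k.
    have hstep : (N m : ℝ) * ((numChosen N n / numChosen N (m + 1)) *
        (sideLength M n / sideLength M (m + 1)) ^ k)
        ≤ B ^ k / c₀ * (numChosen N n * sideLength M n ^ σ) := by
      have hpow : sideLength M n ^ ((k : ℝ) - σ) ≤ sideLength M m ^ ((k : ℝ) - σ) :=
        Real.rpow_le_rpow hrn.le (sideLength_antitone hM hm.le) (by linarith)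
      have hsplit (i : ℕ) : sideLength M i ^ k
          = sideLength M i ^ ((k : ℝ) - σ) * sideLength M i ^ σ := by
        rw [← Real.rpow_add (sideLength_pos hM i), sub_add_cancel, Real.rpow_natCast]
      have hσn := Real.rpow_pos_of_pos hrn σ
      have hkn := Real.rpow_pos_of_pos hrn ((k : ℝ) - σ)
      -- Here σ ≤ k is decisive: r^(k-σ) is then smallest at the finest scale, so the lower bound
      -- for P_m r_m^σ controls all levels at once.
      have hden : c₀ * sideLength M n ^ ((k : ℝ) - σ) ≤ numChosen N m * sideLength M m ^ k := by
        rw [hsplit m]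
        calc _ ≤ (numChosen N m * sideLength M m ^ σ) * sideLength M m ^ ((k : ℝ) - σ) := by
              have := hP m
              gcongr
          _ = _ := by ring
      calc _ = (M m : ℝ) ^ k * numChosen N n * sideLength M n ^ k /
            (numChosen N m * sideLength M m ^ k) := by
            rw [numChosen_succ, sideLength_succ]
            push_cast
            simp only [div_pow, mul_pow, inv_pow]
            field_simp
        _ ≤ B ^ k * numChosen N n * sideLength M n ^ k / (c₀ * sideLength M n ^ ((k : ℝ) - σ)) := by
            gcongr
        _ = _ := by
            rw [hsplit n]
            field_simp
    calc ∑ l ∈ C (m + 1) ω ∩ children j, tubeWeight N n R p θ b (m + 1) l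
        ≤ ∑ _l ∈ C (m + 1) ω ∩ children j, θ * (1 + b) ^ n * (2 * R + 1) ^ d *
          ((numChosen N n / numChosen N (m + 1)) * (sideLength M n / sideLength M (m + 1)) ^ k) :=
          Finset.sum_le_sum fun l _ =>
            tubeWeight_le hM hN hqk (Nat.succ_le_of_lt hm) p hθ hb0 l
      _ = θ * (1 + b) ^ n * (2 * R + 1) ^ d * ((N m : ℝ) *
          ((numChosen N n / numChosen N (m + 1)) *
            (sideLength M n / sideLength M (m + 1)) ^ k)) := by
          rw [Finset.sum_const, (hC.isCantorTree ω).card_chosen m j hj, nsmul_eq_mul]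
          ring
      _ ≤ _ := by gcongr
      _ ≤ b := hsmall

open Classical in
theorem prob_tube_le (hC : IsRandomCantor Pr d M N C) (hM : ∀ n, 2 ≤ M n)
    (hN : ∀ n, 1 ≤ N n) {B : ℕ} (hB : ∀ n, M n ≤ B) (hqk : q + k = d) {t τ σ c₀ : ℝ} (hτσ : τ ≤ σ)
    (hσ : σ ≤ k) (hc₀ : 0 < c₀) (hP : ∀ m, c₀ ≤ numChosen N m * sideLength M m ^ σ) {n R : ℕ}
    (p : (Fin q → Fin d) × (Fin d → ℤ) × (Fin d → Fin q → ℤ)) (hn : 1 ≤ n)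
    (hsmall : Real.exp 1 * (2 * R + 1) ^ d * (B ^ k / c₀ * sideLength M n ^ (σ - τ)) ≤ 1 / n) :
    Pr {ω | numChosen N n * sideLength M n ^ t < ((C n ω).filter (IsTubeCube R p)).card}
      ≤ ENNReal.ofReal (Real.exp (Real.exp 1 * (2 * R + 1) ^ d) *
        Real.exp (-(sideLength M n ^ (t - τ)))) := by
  have hrn := sideLength_pos hM n
  have hPn : (0 : ℝ) < numChosen N n := by exact_mod_cast numChosen_pos hN n
  have hn' : (0 : ℝ) < n := by exact_mod_cast hn
  set r := sideLength M n with hr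
  -- With this θ the threshold P_n r_n^t becomes the exponent r_n^(t-τ), which is large when t < τ.
  -- The inflation b = 1/n keeps (1 + b)^n ≤ e.
  set θ := r ^ (-τ) / numChosen N n with hθ
  have hθ0 : 0 < θ := by positivity
  have hpow : (1 + 1 / (n : ℝ)) ^ n ≤ Real.exp 1 := by
    calc (1 + 1 / (n : ℝ)) ^ n ≤ Real.exp (1 / n) ^ n := by
          gcongr
          rw [add_comm]
          exact Real.add_one_le_exp _
      _ = Real.exp 1 := by
          rw [← Real.exp_nat_mul, mul_one_div_cancel hn'.ne']
  have hmoment := hC.lintegral_exp_tube_le hM hN hB hqk hσ hc₀ hP (n := n) (R := R) p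
    (b := 1 / n) hθ0.le (by positivity) (by
      rw [div_le_one hn']
      exact_mod_cast hn) (by
      calc θ * (1 + 1 / (n : ℝ)) ^ n * (2 * R + 1) ^ d * (B ^ k / c₀ * (numChosen N n * r ^ σ))
          = (1 + 1 / (n : ℝ)) ^ n * (2 * R + 1) ^ d * (B ^ k / c₀ * r ^ (σ - τ)) := by
            rw [hθ, sub_eq_neg_add, Real.rpow_add hrn]
            field_simp
        _ ≤ Real.exp 1 * (2 * R + 1) ^ d * (B ^ k / c₀ * r ^ (σ - τ)) := by gcongr
        _ ≤ _ := hsmall)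
  have hbound : θ * (1 + 1 / (n : ℝ)) ^ n * (2 * R + 1) ^ d * (numChosen N n * r ^ k)
      ≤ Real.exp 1 * (2 * R + 1) ^ d := by
    have hle : r ^ ((k : ℝ) - τ) ≤ 1 :=
      Real.rpow_le_one hrn.le (sideLength_le_one hM n) (by linarith)
    calc _ = (1 + 1 / (n : ℝ)) ^ n * (2 * R + 1) ^ d * r ^ ((k : ℝ) - τ) := by
          rw [hθ, sub_eq_neg_add, Real.rpow_add hrn, Real.rpow_natCast]
          field_simp
      _ ≤ Real.exp 1 * (2 * R + 1) ^ d * 1 := by gcongr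
      _ = _ := mul_one _
  have hmarkov := mul_meas_ge_le_lintegral (μ := Pr) (hC.measurable_comp_level n fun s =>
    ENNReal.ofReal (Real.exp (θ * (s.filter (IsTubeCube R p)).card)))
    (ENNReal.ofReal (Real.exp (r ^ (t - τ))))
  have hθr : θ * (numChosen N n * r ^ t) = r ^ (t - τ) := by
    rw [hθ, sub_eq_neg_add, Real.rpow_add hrn]
    field_simp
  rw [Real.exp_neg, ENNReal.ofReal_mul (Real.exp_pos _).le, ENNReal.ofReal_inv_of_pos
    (Real.exp_pos _), ← div_eq_mul_inv, ENNReal.le_div_iff_mul_le (Or.inl (by simp [Real.exp_pos]))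
    (Or.inl ENNReal.ofReal_ne_top), mul_comm]
  refine le_trans ?_ (hmarkov.trans (hmoment.trans
    (ENNReal.ofReal_le_ofReal (Real.exp_le_exp.2 hbound))))
  gcongr
  rename_i ω
  intro hω
  refine ENNReal.ofReal_le_ofReal (Real.exp_le_exp.2 ?_)
  rw [← hθr]
  exact mul_le_mul_of_nonneg_left (le_of_lt hω) hθ0.le

end IsRandomCantor

/-! ### Union bound and Borel–Cantelli. -/

theorem exists_le_numChosen_mul_rpow {M N : ℕ → ℕ} (hM : ∀ n, 2 ≤ M n) (hN : ∀ n, 1 ≤ N n) {σ : ℝ}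
    (hσ0 : 0 ≤ σ) (hσ : σ < cantorDim M N) :
    ∃ c₀ : ℝ, 0 < c₀ ∧ ∀ m, c₀ ≤ numChosen N m * sideLength M m ^ σ := by
  have hlog (n : ℕ) : 0 ≤ -Real.log (sideLength M n) :=
    neg_nonneg.2 (Real.log_nonpos (sideLength_pos hM n).le (sideLength_le_one hM n))
  have hP (n : ℕ) : (1 : ℝ) ≤ numChosen N n := by exact_mod_cast numChosen_pos hN n
  have hbdd : Filter.IsBoundedUnder (· ≥ ·) Filter.atTop
      (fun n : ℕ => Real.log (numChosen N n : ℝ) / (-Real.log (sideLength M n))) :=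
    Filter.isBoundedUnder_of ⟨0, fun n => div_nonneg (Real.log_nonneg (hP n)) (hlog n)⟩
  have hev := Filter.eventually_lt_of_lt_liminf hσ hbdd
  obtain ⟨m₀, hm₀⟩ := Filter.eventually_atTop.1 hev
  have hr₀ := sideLength_pos hM m₀
  -- Up to m₀ this constant works because P_m ≥ 1 and r_m ≥ r_(m₀); beyond m₀ even P_m r_m^σ ≥ 1.
  refine ⟨sideLength M m₀ ^ σ, Real.rpow_pos_of_pos hr₀ σ, fun m => ?_⟩
  have hr := sideLength_pos hM m
  rcases le_total m m₀ with h | h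
  · calc sideLength M m₀ ^ σ ≤ sideLength M m ^ σ :=
          Real.rpow_le_rpow hr₀.le (sideLength_antitone hM h) hσ0
      _ ≤ _ := le_mul_of_one_le_left (Real.rpow_pos_of_pos hr σ).le (hP m)
  · refine (Real.rpow_le_one hr₀.le (sideLength_le_one hM m₀) hσ0).trans ?_
    have h1 := hm₀ m h
    have hpos : 0 < -Real.log (sideLength M m) := by
      -- If log r_m = 0 the quotient is 0 by the convention for division, which is not greater than
      -- σ ≥ 0.
      refine (hlog m).lt_of_ne fun h0 => ?_
      rw [← h0, div_zero] at h1
      exact absurd h1 (not_lt.2 hσ0)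
    rw [lt_div_iff₀ hpos] at h1
    have h2 : 0 ≤ Real.log (numChosen N m * sideLength M m ^ σ) := by
      rw [Real.log_mul (by linarith [hP m]) (Real.rpow_pos_of_pos hr σ).ne', Real.log_rpow hr]
      linarith
    exact (Real.log_nonneg_iff (mul_pos (by linarith [hP m]) (Real.rpow_pos_of_pos hr σ))).1 h2

/-- Polynomially many events of stretched exponentially small probability. -/
theorem exists_pow_mul_exp_neg_rpow_le (L : ℕ) {η : ℝ} (hη : 0 < η) :
    ∃ K : ℝ, 0 ≤ K ∧ ∀ x : ℝ, 1 ≤ x → x ^ L * Real.exp (-(x ^ η)) ≤ K * x⁻¹ := by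
  -- One term of the exponential series, e^y ≥ y^J/J! with y = x^η and ηJ ≥ L + 1, already beats
  -- x^(L+1); hence K = J!.
  obtain ⟨J, hJ⟩ := exists_nat_ge ((L + 1) / η)
  rw [div_le_iff₀ hη] at hJ
  refine ⟨J.factorial, by positivity, fun x hx => ?_⟩
  have hx0 : 0 < x := by linarith
  have h1 := Real.pow_div_factorial_le_exp (x ^ η) (by positivity) J
  have h2 : x ^ (L + 1) ≤ (x ^ η) ^ J := by
    rw [← Real.rpow_natCast (x ^ η), ← Real.rpow_mul hx0.le, ← Real.rpow_natCast]
    refine Real.rpow_le_rpow_of_exponent_le hx ?_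
    push_cast
    linarith
  have hf : (0 : ℝ) < J.factorial := by exact_mod_cast J.factorial_pos
  rw [Real.exp_neg, ← div_eq_mul_inv, ← div_eq_mul_inv, div_le_div_iff₀ (Real.exp_pos _) hx0,
    ← pow_succ]
  rw [div_le_iff₀ hf] at h1
  linarith

namespace IsRandomCantor

variable {Ω : Type*} [MeasurableSpace Ω] {Pr : Measure Ω} {d q k : ℕ} {M N : ℕ → ℕ}
  {C : (n : ℕ) → Ω → Finset (CubeIdx d M n)} [IsProbabilityMeasure Pr]

open Classical in
theorem ae_card_tube_le (hC : IsRandomCantor Pr d M N C) (hM : ∀ n, 2 ≤ M n) (hN : ∀ n, 1 ≤ N n)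
    {B : ℕ} (hB : ∀ n, M n ≤ B) (hqk : q + k = d) (hs : cantorDim M N ≤ k) (R : ℕ) {t : ℝ}
    (ht0 : 0 < t) (ht : t < cantorDim M N) :
    ∀ᵐ ω ∂Pr, ∃ n₀, ∀ n ≥ n₀, ∀ p ∈ tubeParams d q M n,
      (((C n ω).filter (IsTubeCube R p)).card : ℝ) ≤ numChosen N n * sideLength M n ^ t := by
  -- The gap σ - τ makes the exponents smaller than 1/n, and the gap τ - t makes the tail beat the
  -- number of tubes.
  obtain ⟨σ, htσ, hσ⟩ := exists_between ht
  obtain ⟨τ, htτ, hτσ⟩ := exists_between htσ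
  obtain ⟨c₀, hc₀, hP⟩ := exists_le_numChosen_mul_rpow hM hN (ht0.trans htσ).le hσ
  let F : ℕ → Set Ω := fun n => {ω | ∃ p ∈ tubeParams d q M n,
    numChosen N n * sideLength M n ^ t < ((C n ω).filter (IsTubeCube R p)).card}
  suffices h : ∃ n₁, ∑' n, Pr (F (n + n₁)) ≠ ⊤ by
    obtain ⟨n₁, hn₁⟩ := h
    filter_upwards [ae_eventually_notMem hn₁] with ω hω
    obtain ⟨n₂, hn₂⟩ := Filter.eventually_atTop.1 hω
    refine ⟨n₂ + n₁, fun n hn p hp => ?_⟩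
    have h := hn₂ (n - n₁) (by omega)
    rw [Nat.sub_add_cancel (by omega)] at h
    by_contra! hlt
    exact h ⟨p, hp, hlt⟩
  have hsmall : ∀ᶠ n : ℕ in Filter.atTop, 1 ≤ n ∧ Real.exp 1 * (2 * R + 1) ^ d *
      (B ^ k / c₀ * sideLength M n ^ (σ - τ)) ≤ 1 / n := by
    have hx1 : ((1 / 2 : ℝ) ^ (σ - τ)) < 1 :=
      Real.rpow_lt_one (by norm_num) (by norm_num) (by linarith)
    have hlim := (tendsto_self_mul_const_pow_of_lt_one (by positivity) hx1).const_mul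
      (Real.exp 1 * (2 * R + 1) ^ d * (B ^ k / c₀))
    rw [mul_zero] at hlim
    filter_upwards [hlim.eventually_le_const one_pos, Filter.eventually_ge_atTop 1] with n hn hn1
    have hn' : (0 : ℝ) < n := by exact_mod_cast hn1
    refine ⟨hn1, ?_⟩
    rw [le_div_iff₀ hn']
    refine le_trans ?_ hn
    have : sideLength M n ^ (σ - τ) ≤ ((1 / 2 : ℝ) ^ (σ - τ)) ^ n := by
      rw [← Real.rpow_natCast, ← Real.rpow_mul (by norm_num), mul_comm (σ - τ), Real.rpow_mul
        (by norm_num), Real.rpow_natCast]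
      exact Real.rpow_le_rpow (sideLength_pos hM n).le (sideLength_le_two_pow hM n) (by linarith)
    calc _ = Real.exp 1 * (2 * R + 1) ^ d * (B ^ k / c₀) * (n * sideLength M n ^ (σ - τ)) := by ring
      _ ≤ _ := by gcongr
  obtain ⟨n₁, hn₁⟩ := Filter.eventually_atTop.1 hsmall
  refine ⟨n₁, ?_⟩
  obtain ⟨K, hK0, hK⟩ := exists_pow_mul_exp_neg_rpow_le (d + d * q) (sub_pos.2 htτ)
  set A := Real.exp (Real.exp 1 * (2 * R + 1) ^ d) with hA
  -- The number of tubes is at most c₁ r_n^(-(d + dq)); the summand 1 in its base is absorbed using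
  -- r_n⁻¹ ≥ 1.
  set c₁ : ℝ := d ^ q * (2 * (q + 2) + 1) ^ (d + d * q) with hc₁
  have hF (n : ℕ) (hn : n₁ ≤ n) : Pr (F n) ≤ ENNReal.ofReal (c₁ * A * K * (1 / 2) ^ n) := by
    obtain ⟨hn1, hsm⟩ := hn₁ n hn
    have hr := sideLength_pos hM n
    have hx : 1 ≤ (sideLength M n)⁻¹ := (one_le_inv₀ hr).2 (sideLength_le_one hM n)
    have hQ : ((∏ i ∈ Finset.range n, M i : ℕ) : ℝ) = (sideLength M n)⁻¹ := by
      rw [sideLength_eq, inv_inv]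
    have hcard : ((tubeParams d q M n).card : ℝ) ≤ c₁ * (sideLength M n)⁻¹ ^ (d + d * q) := by
      rw [card_tubeParams, hc₁, mul_assoc, ← mul_pow]
      push_cast
      push_cast at hQ
      rw [hQ]
      gcongr
      linarith
    calc Pr (F n) ≤ Pr (⋃ p ∈ tubeParams d q M n, {ω | numChosen N n * sideLength M n ^ t <
            ((C n ω).filter (IsTubeCube R p)).card}) := by
          refine measure_mono fun ω ⟨p, hp, h⟩ => Set.mem_biUnion hp h
      _ ≤ ∑ p ∈ tubeParams d q M n, Pr {ω | numChosen N n * sideLength M n ^ t <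
            ((C n ω).filter (IsTubeCube R p)).card} := measure_biUnion_finset_le _ _
      _ ≤ ∑ _p ∈ tubeParams d q M n,
            ENNReal.ofReal (A * Real.exp (-(sideLength M n ^ (t - τ)))) :=
          Finset.sum_le_sum fun p _ =>
            hC.prob_tube_le hM hN hB hqk hτσ.le (hσ.le.trans hs) hc₀ hP p hn1 hsm
      _ = ENNReal.ofReal ((tubeParams d q M n).card *
            (A * Real.exp (-(sideLength M n ^ (t - τ))))) := by
          rw [Finset.sum_const, nsmul_eq_mul, ENNReal.ofReal_mul (Nat.cast_nonneg _),
            ENNReal.ofReal_natCast]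
      _ ≤ ENNReal.ofReal (c₁ * A * K * (1 / 2) ^ n) := by
          refine ENNReal.ofReal_le_ofReal ?_
          have hexp : sideLength M n ^ (t - τ) = (sideLength M n)⁻¹ ^ (τ - t) := by
            rw [Real.inv_rpow hr.le, ← Real.rpow_neg hr.le, neg_sub]
          have hKn := hK _ hx
          rw [inv_inv] at hKn
          have hc₁0 : 0 ≤ c₁ := by positivity
          calc _ ≤ (c₁ * (sideLength M n)⁻¹ ^ (d + d * q)) *
                (A * Real.exp (-((sideLength M n)⁻¹ ^ (τ - t)))) := by
                rw [hexp]
                gcongr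
            _ = c₁ * A * ((sideLength M n)⁻¹ ^ (d + d * q) *
                Real.exp (-((sideLength M n)⁻¹ ^ (τ - t)))) := by ring
            _ ≤ c₁ * A * (K * sideLength M n) := by gcongr
            _ ≤ c₁ * A * (K * (1 / 2) ^ n) := by
                gcongr
                exact sideLength_le_two_pow hM n
            _ = _ := by ring
  have hsummable : Summable fun n : ℕ => c₁ * A * K * (1 / 2 : ℝ) ^ (n + n₁) :=
    ((summable_nat_add_iff n₁).2 (summable_geometric_of_lt_one (by norm_num)
      (by norm_num))).mul_left _
  exact ne_top_of_le_ne_top hsummable.tsum_ofReal_ne_top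
    (ENNReal.tsum_le_tsum fun n => hF (n + n₁) (Nat.le_add_left _ _))

end IsRandomCantor

/-! ### From tubes to strips. -/

theorem exists_sideLength_lt_le {M : ℕ → ℕ} (hM : ∀ n, 2 ≤ M n) {n₀ : ℕ} {δ : ℝ} (hδ : 0 < δ)
    (hδ₀ : δ ≤ sideLength M n₀) : ∃ n ≥ n₀, sideLength M (n + 1) < δ ∧ δ ≤ sideLength M n := by
  by_contra! h
  have hall (n : ℕ) (hn : n₀ ≤ n) : δ ≤ sideLength M n := by
    induction n, hn using Nat.le_induction with
    | base => exact hδ₀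
    | succ n hn ih => exact not_lt.1 fun hlt => absurd ih (not_le.2 (h n hn hlt))
  exact absurd (ge_of_tendsto (tendsto_sideLength hM)
    (Filter.eventually_atTop.2 ⟨n₀, hall⟩)) (not_le.2 hδ)

open Classical in
theorem IsNaturalMeasure.measure_strip_le {d q : ℕ} {M N : ℕ → ℕ}
    {c : (n : ℕ) → Finset (CubeIdx d M n)} {μ : Measure (EuclideanSpace ℝ (Fin d))}
    (hμ : IsNaturalMeasure N c μ) (hM : ∀ n, 2 ≤ M n) (hN : ∀ n, 1 ≤ N n) {n : ℕ} {t : ℝ}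
    (hcard : ∀ p ∈ tubeParams d q M n, (((c n).filter (IsTubeCube (3 + 3 * q) p)).card : ℝ)
      ≤ numChosen N n * sideLength M n ^ t)
    {W : AffineSubspace ℝ (EuclideanSpace ℝ (Fin d))} (hW : W ∈ planesMeetingCube d q) {δ : ℝ}
    (hδ : δ ≤ sideLength M n) : μ (strip W δ) ≤ ENNReal.ofReal (sideLength M n ^ t) := by
  obtain ⟨p, hp, hcover⟩ := exists_tubeParams hM hW hδ
  have hPn : (0 : ℝ) < numChosen N n := by exact_mod_cast numChosen_pos hN n
  let S : Finset (CubeIdx d M n) := Finset.univ.filter (IsTubeCube (3 + 3 * q) p)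
  calc μ (strip W δ) ≤ μ ((⋃ j ∈ S, adicCube j) ∪ (unitCube d)ᶜ) := by
        refine measure_mono fun x hx => ?_
        by_cases hxu : x ∈ unitCube d
        · obtain ⟨j, hj⟩ := exists_mem_adicCube hM n hxu
          exact Or.inl (Set.mem_biUnion (Finset.mem_coe.2 (Finset.mem_filter.2
            ⟨Finset.mem_univ _, hcover j ⟨x, hj, hx⟩⟩)) hj)
        · exact Or.inr hxu
    _ ≤ μ (⋃ j ∈ S, adicCube j) + μ (unitCube d)ᶜ := measure_union_le _ _
    _ ≤ ∑ j ∈ S, cubeMass N c j := by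
        rw [hμ.1, add_zero]
        exact hμ.measure_biUnion_le S
    _ = ENNReal.ofReal (((c n).filter (IsTubeCube (3 + 3 * q) p)).card * (numChosen N n : ℝ)⁻¹) := by
        rw [sum_cubeMass, ENNReal.ofReal_mul (Nat.cast_nonneg _), ENNReal.ofReal_inv_of_pos hPn,
          ENNReal.ofReal_natCast, ENNReal.ofReal_natCast]
        congr 3
        ext l
        simp [S]
    _ ≤ _ := by
        refine ENNReal.ofReal_le_ofReal ?_
        rw [mul_inv_le_iff₀ hPn]
        exact (hcard p hp).trans_eq (mul_comm _ _)

end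

theorem lemma2p3 {Ω : Type*} [MeasurableSpace Ω] (Pr : Measure Ω) [IsProbabilityMeasure Pr]
    (d k : ℕ) (hk : 1 ≤ k) (hkd : k < d) (M N : ℕ → ℕ)
    (hM : ∀ n, 2 ≤ M n) (hMb : ∃ B : ℕ, ∀ n, M n ≤ B)
    (hN : ∀ n, 1 ≤ N n) (hNM : ∀ n, N n ≤ M n ^ d)
    (C : (n : ℕ) → Ω → Finset (CubeIdx d M n)) (hC : IsRandomCantor Pr d M N C)
    (hs : cantorDim M N ≤ (k : ℝ)) :
    ∀ᵐ ω ∂Pr, ∃ μ : Measure (EuclideanSpace ℝ (Fin d)),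
      IsNaturalMeasure N (fun n => C n ω) μ ∧
      (∀ ν : Measure (EuclideanSpace ℝ (Fin d)),
        IsNaturalMeasure N (fun n => C n ω) ν → ν = μ) ∧
      ∀ t : ℝ, 0 < t → t < cantorDim M N →
        (⨆ W ∈ planesMeetingCube d (d - k), ⨆ δ : ℝ, ⨆ _ : 0 < δ,
          μ (limitSet (fun n => C n ω) ∩ strip W δ) / ENNReal.ofReal (δ ^ t)) < ⊤ := by
  classical
  obtain ⟨B, hB⟩ := hMb
  -- Rational exponents give one null set for all t: a real t < s is handled through a rational t'
  -- strictly between t and s.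
  have htubes : ∀ᵐ ω ∂Pr, ∀ t : ℚ, (0 : ℝ) < t → (t : ℝ) < cantorDim M N →
      ∃ n₀, ∀ n ≥ n₀, ∀ p ∈ tubeParams d (d - k) M n,
        (((C n ω).filter (IsTubeCube (3 + 3 * (d - k)) p)).card : ℝ)
          ≤ numChosen N n * sideLength M n ^ (t : ℝ) := by
    simp_rw [ae_all_iff]
    exact fun t ht0 ht =>
      hC.ae_card_tube_le hM hN hB (Nat.sub_add_cancel hkd.le) hs (3 + 3 * (d - k)) ht0 ht
  filter_upwards [htubes, hC.ae_tendsto_slabMass hM hN] with ω hω hslab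
  have hc := hC.isCantorTree ω
  obtain ⟨μ, hμ⟩ := hc.exists_isNaturalMeasure hM hN hslab
  have hprob := hμ.isProbabilityMeasure hc
  refine ⟨μ, hμ, fun ν hν => hμ.unique hν hc hM hN, fun t ht0 ht => ?_⟩
  obtain ⟨t', htt', ht's⟩ := exists_rat_btwn ht
  obtain ⟨n₀, hn₀⟩ := hω t' (ht0.trans htt') ht's
  have hr₀ := sideLength_pos hM n₀
  -- The first term of the maximum serves widths δ ≥ r_(n₀), where total mass 1 suffices. The second
  -- serves smaller δ, for which r_(n+1) < δ ≤ r_n gives r_n ≤ Bδ.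
  refine lt_of_le_of_lt (b := ENNReal.ofReal (max ((sideLength M n₀ ^ t)⁻¹) ((B : ℝ) ^ (t' : ℝ))))
    ?_ ENNReal.ofReal_lt_top
  refine iSup₂_le fun W hW => iSup₂_le fun δ hδ => ?_
  have hδt := Real.rpow_pos_of_pos hδ t
  refine ENNReal.div_le_of_le_mul ?_
  rw [← ENNReal.ofReal_mul (le_max_of_le_left (by positivity))]
  refine (measure_mono Set.inter_subset_right).trans ?_
  rcases le_or_gt (sideLength M n₀) δ with h | h
  · refine prob_le_one.trans (ENNReal.one_le_ofReal.2 ?_)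
    calc (1 : ℝ) = (sideLength M n₀ ^ t)⁻¹ * sideLength M n₀ ^ t :=
          (inv_mul_cancel₀ (Real.rpow_pos_of_pos hr₀ t).ne').symm
      _ ≤ _ := by
          gcongr
          exact le_max_left _ _
  · obtain ⟨n, hn, hlt, hle⟩ := exists_sideLength_lt_le hM hδ h.le
    refine (hμ.measure_strip_le hM hN (hn₀ n hn) hW hle).trans (ENNReal.ofReal_le_ofReal ?_)
    have hMn : (0 : ℝ) < M n := by exact_mod_cast (by have := hM n; omega : 0 < M n)
    have hnδ : sideLength M n ≤ B * δ := by
      calc sideLength M n = M n * sideLength M (n + 1) := by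
            rw [sideLength_succ]
            field_simp
        _ ≤ B * δ := by
            gcongr
            · exact (sideLength_pos hM _).le
            · exact hB n
    have ht'0 : (0 : ℝ) < t' := ht0.trans htt'
    calc sideLength M n ^ (t' : ℝ) ≤ (B * δ) ^ (t' : ℝ) :=
          Real.rpow_le_rpow (sideLength_pos hM n).le hnδ ht'0.le
      _ = (B : ℝ) ^ (t' : ℝ) * δ ^ (t' : ℝ) := Real.mul_rpow (Nat.cast_nonneg _) hδ.le
      _ ≤ (B : ℝ) ^ (t' : ℝ) * δ ^ t := by
          gcongr _ * ?_
          exact Real.rpow_le_rpow_of_exponent_ge hδ (hle.trans (sideLength_le_one hM n)) htt'.le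
      _ ≤ _ := by
          gcongr
          exact le_max_right _ _
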